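/- A signed graph $\dot G=(G,\sigma)$ is a finite simple graph $G$ with a sign function $\sigma:E(G)\to\{+1,-1\}$; its adjacency matrix $A_{\dot G}$ has entry $\sigma(uv)$ at $(u,v)$ if $uv\in E(G)$ and $0$ otherwise. $\dot G$ is $r$-regular if every vertex has degree $r$ in $G$, and $\rho$ net-regular if at every vertex the number of positive edges minus the number of negative edges is $\rho$; it is homogeneous if all its edges have the same sign. $\dot G$ is strongly regular with parameters $(n,r,a,b,c)$, where $n=|V(G)|$, $r\in\mathbb N$ and $a,b,c\in\mathbb Z$, if it is neither homogeneous complete nor edgeless and the $(u,v)$ entry of $A_{\dot G}^2$ is $r$ if $u=v$, $a$ if $uv$ is a positive edge, $b$ if $uv$ is a negative edge, and $c$ if $u\ne v$ are non-adjacent. An SRSG is an inhomogeneous signed graph that is strongly regular for some parameters. Isomorphisms of signed graphs are graph isomorphisms preserving all edge signs, and $-\dot G$ is $\dot G$ with all signs reversed. Let $\dot S^4_8$ be the signed graph with vertex set $\{1,2,3,4\}\times\{0,1\}$ in which $(x,i)$ and $(y,j)$ are adjacent iff $x\neq y$, the edge being positive iff $i=j$. Let $\dot S_{16}$ be the signed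 graph with vertex set $\{1,2,3,4\}^2$ in which two distinct vertices are joined by a positive edge if their first coordinates agree, by a negative edge if their second coordinates agree, and are non-adjacent otherwise. **Theorem.** A signed graph is a connected $6$-regular and $0$ net-regular SRSG if and only if it is isomorphic to one of $\dot S^4_8$, $-\dot S^4_8$, $\dot S_{16}$, $-\dot S_{16}$. Moreover: - $\dot S^4_8$ has parameters $(8,6,4,-4,-6)$ and $-\dot S^4_8$ has parameters $(8,6,-4,4,-6)$; both $\dot S_{16}$ and $-\dot S_{16}$ have parameters $(16,6,2,2,-2)$. - The underlying graph of $\dot S^4_8$ is, up to isomorphism, the unique $6$-regular graph of order $8$. - The subgraphs of $\dot S_{16}$ formed by the positive edges and by the negative edges are both disjoint unions of copies of $K_4$. - $\dot S^4_8$ and $-\dot S^4_8$ are not isomorphic, while $\dot S_{16}$ and $-\dot S_{16}$ are isomorphic. -/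

import Mathlib

/-- A signed graph on the vertex set `V`: a simple graph together with a sign, `+1` or `-1`
(a unit of `ℤ`), for each of its edges. -/
structure SignedGraph (V : Type*) where
  graph : SimpleGraph V
  sign : graph.edgeSet → ℤˣ

namespace SignedGraph

/-- Two signed graphs are isomorphic if some isomorphism of the underlying graphs preserves the
sign of every edge. -/
def IsIsomorphic {V W : Type*} (S : SignedGraph V) (T : SignedGraph W) : Prop :=
  ∃ f : S.graph ≃g T.graph, ∀ e : S.graph.edgeSet, T.sign (f.mapEdgeSet e) = S.sign e

/-- The negation of a signed graph: all signs are reversed. -/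
instance {V : Type*} : Neg (SignedGraph V) where
  neg S := ⟨S.graph, fun e => -S.sign e⟩

/-- The spanning subgraph formed by the edges of sign `ε`. -/
def part {V : Type*} (S : SignedGraph V) (ε : ℤˣ) : SimpleGraph V where
  Adj u v := ∃ h : S.graph.Adj u v, S.sign ⟨s(u, v), h⟩ = ε
  symm := ⟨fun u v ⟨h, hs⟩ => ⟨h.symm, by
    rw [← hs]; congr 2; exact Sym2.eq_swap⟩⟩
  loopless := ⟨fun u ⟨h, _⟩ => S.graph.irrefl h⟩

/-- The spanning subgraph formed by the positive edges. -/
def posPart {V : Type*} (S : SignedGraph V) : SimpleGraph V := S.part 1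

/-- The spanning subgraph formed by the negative edges. -/
def negPart {V : Type*} (S : SignedGraph V) : SimpleGraph V := S.part (-1)

open Classical in
/-- The adjacency matrix: the entry at `(u, v)` is the sign of the edge `uv`, and `0` if there is
no such edge. -/
noncomputable def adjMatrix {V : Type*} (S : SignedGraph V) : Matrix V V ℤ :=
  Matrix.of fun u v => if h : S.graph.Adj u v then (S.sign ⟨s(u, v), h⟩ : ℤ) else 0

open Classical in
/-- Every vertex has degree `r` in the underlying graph. -/
def IsRegular {V : Type*} [Fintype V] (S : SignedGraph V) (r : ℕ) : Prop :=
  S.graph.IsRegularOfDegree r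

open Classical in
/-- The net-degree of a vertex: its positive degree minus its negative degree. -/
noncomputable def netDegree {V : Type*} [Fintype V] (S : SignedGraph V) (v : V) : ℤ :=
  (S.posPart.degree v : ℤ) - (S.negPart.degree v : ℤ)

/-- Every vertex has net-degree `ρ`. -/
def IsNetRegular {V : Type*} [Fintype V] (S : SignedGraph V) (ρ : ℤ) : Prop :=
  ∀ v, S.netDegree v = ρ

/-- All edges have the same sign. -/
def IsHomogeneous {V : Type*} (S : SignedGraph V) : Prop :=
  ∀ e e' : S.graph.edgeSet, S.sign e = S.sign e'

/-- The entries of the square of the adjacency matrix are `r` on the diagonal, `a` at positively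
adjacent pairs, `b` at negatively adjacent pairs, and `c` at distinct non-adjacent pairs. -/
structure SquareEntries {V : Type*} [Fintype V] (S : SignedGraph V) (r : ℕ) (a b c : ℤ) :
    Prop where
  diag : ∀ u, (S.adjMatrix * S.adjMatrix) u u = r
  pos : ∀ u v, S.posPart.Adj u v → (S.adjMatrix * S.adjMatrix) u v = a
  neg : ∀ u v, S.negPart.Adj u v → (S.adjMatrix * S.adjMatrix) u v = b
  nonadj : ∀ u v, u ≠ v → ¬ S.graph.Adj u v → (S.adjMatrix * S.adjMatrix) u v = c

/-- Strong regularity: neither homogeneous complete nor edgeless, and the square of the adjacency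
matrix has entries prescribed by some `r`, `a`, `b`, `c`. -/
def IsStronglyRegular {V : Type*} [Fintype V] (S : SignedGraph V) : Prop :=
  ¬ (S.IsHomogeneous ∧ S.graph = ⊤) ∧ S.graph ≠ ⊥ ∧
    ∃ (r : ℕ) (a b c : ℤ), S.SquareEntries r a b c

/-- An SRSG: an inhomogeneous strongly regular signed graph. -/
def IsSRSG {V : Type*} [Fintype V] (S : SignedGraph V) : Prop :=
  S.IsStronglyRegular ∧ ¬ S.IsHomogeneous

/-- The signed graph is strongly regular with parameters `(n, r, a, b, c)`. -/
def HasParameters {V : Type*} [Fintype V] (S : SignedGraph V) (n r : ℕ) (a b c : ℤ) : Prop :=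
  S.IsStronglyRegular ∧ Fintype.card V = n ∧ S.SquareEntries r a b c

open Classical in
/-- The signed graph with underlying graph `G` in which precisely the edges of `G` that are also
edges of `P` are positive. -/
noncomputable def ofPositive {V : Type*} (G P : SimpleGraph V) : SignedGraph V where
  graph := G
  sign e := if e.1 ∈ P.edgeSet then 1 else -1

/-- The signed graph `Ṡ⁴₈`. The underlying graph is the complete multipartite graph with four
parts `{(x, 0), (x, 1)}` of size two; the positive edges form the two disjoint copies
`{(x, i) | x}` of `K₄`, and the remaining edges are negative. -/
noncomputable def S8 : SignedGraph (Fin 4 × Fin 2) :=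
  ofPositive (SimpleGraph.fromRel fun p q => p.1 ≠ q.1)
    (SimpleGraph.fromRel fun p q => p.2 = q.2)

/-- The signed graph `Ṡ₁₆` on a `4 × 4` grid: two distinct cells are joined by a positive edge if
they lie in the same row, and by a negative edge if they lie in the same column. -/
noncomputable def S16 : SignedGraph (Fin 4 × Fin 4) :=
  ofPositive (SimpleGraph.fromRel fun p q => p.1 = q.1 ∨ p.2 = q.2)
    (SimpleGraph.fromRel fun p q => p.1 = q.1)

end SignedGraph

/-- The graph is a disjoint union of copies of `K₄`: every connected component is a clique with
four vertices. -/
def IsDisjointUnionOfK4 {V : Type*} (G : SimpleGraph V) : Prop :=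
  ∀ C : G.ConnectedComponent, G.IsClique C.supp ∧ C.supp.ncard = 4

/-! Let `P` and `N` be the positive and negative graphs. Degree 6 and net-degree 0 make both cubic,
and strong regularity says that A = P - N satisfies A² = (6-c)I + (a-c)P + (b-c)N + cJ, where AJ =
JA = 0. Since A commutes with A², (a+b-2c)(PN - NP) = 0; the row-sum equation makes the coefficient
nonzero, so PN = NP (`IsCubicPair.commute`).

Fix a vertex u. Let x, y be the numbers of positive and negative edges inside its positive
neighbourhood, and z, w the same numbers inside its negative neighbourhood. Commutativity forces
exactly 2y positive and 2z negative edges between the two neighbourhoods, so x, y, z, w determine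
how many walks of length two from u of each sign pattern end in each neighbourhood and among the
non-neighbours. Integrality and the equation for c leave few quadruples. Excluding those
contradictory at u (`IsCubicPair.local_structure`) or at a neighbour of u
(`IsCubicPair.classification`) leaves the cases where the positive neighbourhoods, the negative
ones, or both, are cliques throughout.

A cubic graph whose neighbourhoods are cliques is a disjoint union of K₄'s, so 4 divides n; this
discards n = 10 and leaves 8 and 16. Two transversal partitions then coordinatize the vertices as a
grid: non-adjacent pairs against K₄'s for n = 8, positive K₄'s against negative K₄'s for n = 16. The
converse is a finite computation on the two models, carried over by negation and isomorphism. -/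

section CubicPair

open Classical

variable {V : Type*}

/-! ### Matrix identities for a cubic pair -/

theorem SimpleGraph.adjMatrix_eq_zero_or_one (G : SimpleGraph V) (u v : V) :
    G.adjMatrix ℤ u v = 0 ∨ G.adjMatrix ℤ u v = 1 := by
  rw [SimpleGraph.adjMatrix_apply]; split_ifs <;> simp

theorem SimpleGraph.adjMatrix_eq_one_iff (G : SimpleGraph V) (u v : V) :
    G.adjMatrix ℤ u v = 1 ↔ G.Adj u v := by
  rw [SimpleGraph.adjMatrix_apply]; split_ifs <;> simp_all

theorem SimpleGraph.adjMatrix_comm (G : SimpleGraph V) (u v : V) :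
    G.adjMatrix ℤ u v = G.adjMatrix ℤ v u := by
  simp [SimpleGraph.adjMatrix_apply, SimpleGraph.adj_comm]

variable [Fintype V]

/-- Two edge-disjoint cubic graphs `P` and `N` such that the square of the difference of their
adjacency matrices is constant on the edges of `P`, on the edges of `N`, and on the pairs of
distinct vertices adjacent in neither graph. -/
structure IsCubicPair (P N : SimpleGraph V) (a b c : ℤ) : Prop where
  disjoint : ∀ u v, P.Adj u v → ¬ N.Adj u v
  pos_regular : P.IsRegularOfDegree 3
  neg_regular : N.IsRegularOfDegree 3
  sq_pos : ∀ u v, P.Adj u v →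
    ((P.adjMatrix ℤ - N.adjMatrix ℤ) * (P.adjMatrix ℤ - N.adjMatrix ℤ)) u v = a
  sq_neg : ∀ u v, N.Adj u v →
    ((P.adjMatrix ℤ - N.adjMatrix ℤ) * (P.adjMatrix ℤ - N.adjMatrix ℤ)) u v = b
  sq_nonadj : ∀ u v, u ≠ v → ¬ P.Adj u v → ¬ N.Adj u v →
    ((P.adjMatrix ℤ - N.adjMatrix ℤ) * (P.adjMatrix ℤ - N.adjMatrix ℤ)) u v = c

theorem SimpleGraph.IsRegularOfDegree.even_card {G : SimpleGraph V}
    (h : G.IsRegularOfDegree 3) : Even (Fintype.card V) := by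
  have := G.sum_degrees_eq_twice_card_edges
  simp only [h.degree_eq, Finset.sum_const, Finset.card_univ, smul_eq_mul] at this
  rw [Nat.even_iff]
  omega

theorem SimpleGraph.sum_adjMatrix_mul {G : SimpleGraph V} {u v₁ v₂ v₃ : V}
    (h : G.neighborFinset u = {v₁, v₂, v₃}) (h₁₂ : v₁ ≠ v₂) (h₁₃ : v₁ ≠ v₃) (h₂₃ : v₂ ≠ v₃)
    (f : V → ℤ) : ∑ w, G.adjMatrix ℤ u w * f w = f v₁ + f v₂ + f v₃ := by
  have : ∑ w, G.adjMatrix ℤ u w * f w = ∑ w ∈ G.neighborFinset u, f w := by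
    simp [SimpleGraph.adjMatrix_apply, SimpleGraph.neighborFinset_eq_filter, Finset.sum_filter]
  rw [this, h, Finset.sum_insert (by simp [h₁₂, h₁₃]), Finset.sum_insert (by simp [h₂₃]),
    Finset.sum_singleton, add_assoc]

theorem SimpleGraph.IsRegularOfDegree.sum_adjMatrix {G : SimpleGraph V} {k : ℕ}
    (h : G.IsRegularOfDegree k) (u : V) : ∑ w, G.adjMatrix ℤ u w = k := by
  rw [← h.degree_eq u, ← SimpleGraph.card_neighborFinset_eq_degree,
    SimpleGraph.neighborFinset_eq_filter]
  simp [SimpleGraph.adjMatrix_apply]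

namespace IsCubicPair

variable {P N : SimpleGraph V} {a b c : ℤ}

theorem swap (h : IsCubicPair P N a b c) : IsCubicPair N P b a c := by
  have e : (N.adjMatrix ℤ - P.adjMatrix ℤ) * (N.adjMatrix ℤ - P.adjMatrix ℤ) =
      (P.adjMatrix ℤ - N.adjMatrix ℤ) * (P.adjMatrix ℤ - N.adjMatrix ℤ) := by
    noncomm_ring
  refine ⟨fun u v hN hP => h.disjoint u v hP hN, h.neg_regular, h.pos_regular, ?_, ?_, ?_⟩ <;>
    rw [e]
  exacts [h.sq_neg, h.sq_pos, fun u v h₁ h₂ h₃ => h.sq_nonadj u v h₁ h₃ h₂]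

theorem adjMatrix_add_le (h : IsCubicPair P N a b c) (u v : V) :
    P.adjMatrix ℤ u v + N.adjMatrix ℤ u v ≤ 1 := by
  have := h.disjoint u v
  simp only [SimpleGraph.adjMatrix_apply]
  split_ifs <;> simp_all

theorem sq_diag (h : IsCubicPair P N a b c) (u : V) :
    ((P.adjMatrix ℤ - N.adjMatrix ℤ) * (P.adjMatrix ℤ - N.adjMatrix ℤ)) u u = 6 := by
  have e : ∀ w, (P.adjMatrix ℤ - N.adjMatrix ℤ) u w * (P.adjMatrix ℤ - N.adjMatrix ℤ) w u =
      P.adjMatrix ℤ u w + N.adjMatrix ℤ u w := by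
    intro w
    have h₁ := h.adjMatrix_add_le u w
    rw [Matrix.sub_apply, Matrix.sub_apply, P.adjMatrix_comm w u, N.adjMatrix_comm w u]
    rcases P.adjMatrix_eq_zero_or_one u w with h₂ | h₂ <;>
      rcases N.adjMatrix_eq_zero_or_one u w with h₃ | h₃ <;> simp_all
  rw [Matrix.mul_apply, Finset.sum_congr rfl fun w _ => e w, Finset.sum_add_distrib,
    h.pos_regular.sum_adjMatrix, h.neg_regular.sum_adjMatrix]
  norm_num

theorem sq_eq (h : IsCubicPair P N a b c) :
    (P.adjMatrix ℤ - N.adjMatrix ℤ) * (P.adjMatrix ℤ - N.adjMatrix ℤ) =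
      (6 - c) • (1 : Matrix V V ℤ) + (a - c) • P.adjMatrix ℤ + (b - c) • N.adjMatrix ℤ
        + c • Matrix.of fun _ _ => 1 := by
  ext u v
  simp only [Matrix.add_apply, Matrix.smul_apply, Matrix.one_apply, Matrix.of_apply, smul_eq_mul]
  by_cases huv : u = v
  · subst huv
    rw [h.sq_diag]
    simp [SimpleGraph.adjMatrix_apply]
  by_cases hP : P.Adj u v
  · rw [h.sq_pos u v hP]
    simp [SimpleGraph.adjMatrix_apply, hP, h.disjoint u v hP, huv]
  by_cases hN : N.Adj u v
  · rw [h.sq_neg u v hN]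
    simp [SimpleGraph.adjMatrix_apply, hP, hN, huv]
  · rw [h.sq_nonadj u v huv hP hN]
    simp [SimpleGraph.adjMatrix_apply, hP, hN, huv]

theorem sub_mul_ones (h : IsCubicPair P N a b c) :
    (P.adjMatrix ℤ - N.adjMatrix ℤ) * (Matrix.of fun _ _ => 1) = 0 := by
  ext u v
  simp [Matrix.mul_apply, Finset.sum_sub_distrib, h.pos_regular.sum_adjMatrix,
    h.neg_regular.sum_adjMatrix, -SimpleGraph.adjMatrix_apply]

theorem ones_mul_sub (h : IsCubicPair P N a b c) :
    (Matrix.of fun _ _ => 1) * (P.adjMatrix ℤ - N.adjMatrix ℤ) = 0 := by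
  ext u v
  simp [Matrix.mul_apply, Finset.sum_sub_distrib, h.pos_regular.sum_adjMatrix,
    h.neg_regular.sum_adjMatrix, -SimpleGraph.adjMatrix_apply, P.adjMatrix_comm _ v,
    N.adjMatrix_comm _ v]

/-- The row sums of the square of the signed adjacency matrix vanish. -/
theorem parameters_eq (h : IsCubicPair P N a b c) [Nonempty V] :
    6 + 3 * a + 3 * b + c * ((Fintype.card V : ℤ) - 7) = 0 := by
  obtain ⟨u⟩ := ‹Nonempty V›
  have h₁ := congrArg (fun M => M * (Matrix.of fun _ _ => 1 : Matrix V V ℤ)) h.sq_eq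
  beta_reduce at h₁
  rw [Matrix.mul_assoc, h.sub_mul_ones, Matrix.mul_zero] at h₁
  replace h₁ := congrFun (congrFun h₁ u) u
  simp only [Matrix.mul_apply, Matrix.add_apply, Matrix.smul_apply, Matrix.of_apply, mul_one,
    Finset.sum_add_distrib, smul_eq_mul, ← Finset.mul_sum, h.pos_regular.sum_adjMatrix,
    h.neg_regular.sum_adjMatrix, Matrix.one_apply, Matrix.zero_apply] at h₁
  simp at h₁
  linarith

/-- A closed neighbourhood has seven vertices, and a cubic graph has even order. -/
theorem card_ge (h : IsCubicPair P N a b c) [Nonempty V] : 8 ≤ Fintype.card V := by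
  obtain ⟨u⟩ := ‹Nonempty V›
  have h₁ := h.pos_regular.even_card
  have h₂ : Disjoint (P.neighborFinset u) (N.neighborFinset u) := by
    rw [Finset.disjoint_left]
    intro v; simpa using h.disjoint u v
  have h₃ : (insert u (P.neighborFinset u ∪ N.neighborFinset u)).card = 7 := by
    rw [Finset.card_insert_of_notMem (by simp), Finset.card_union_of_disjoint h₂,
      SimpleGraph.card_neighborFinset_eq_degree, SimpleGraph.card_neighborFinset_eq_degree,
      h.pos_regular.degree_eq, h.neg_regular.degree_eq]
  have h₄ := Finset.card_le_univ (insert u (P.neighborFinset u ∪ N.neighborFinset u))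
  rw [Nat.even_iff] at h₁
  omega

/-- The signed matrix commutes with its square, in which I and J contribute nothing to the
commutator. This is what later relates edges between the two neighbourhoods of a vertex to edges
inside them. -/
theorem commute (h : IsCubicPair P N a b c) [Nonempty V] :
    P.adjMatrix ℤ * N.adjMatrix ℤ = N.adjMatrix ℤ * P.adjMatrix ℤ := by
  have h₁ := congrArg (fun M => (P.adjMatrix ℤ - N.adjMatrix ℤ) * M) h.sq_eq
  have h₂ := congrArg (fun M => M * (P.adjMatrix ℤ - N.adjMatrix ℤ)) h.sq_eq
  simp only [mul_add, add_mul, Matrix.mul_smul, Matrix.smul_mul, h.sub_mul_ones, h.ones_mul_sub,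
    mul_assoc, one_mul, mul_one] at h₁ h₂
  have h₃ := h₁.symm.trans h₂
  -- With A = P - N, the commutators AP - PA and AN - NA both equal PN - NP.
  have h₄ : (a + b - 2 * c) • (P.adjMatrix ℤ * N.adjMatrix ℤ) =
      (a + b - 2 * c) • (N.adjMatrix ℤ * P.adjMatrix ℤ) := by
    rw [← sub_eq_zero] at h₃ ⊢
    rw [← h₃]
    simp only [sub_mul, mul_sub]
    module
  -- If a + b = 2c, the row-sum equation becomes c(n-1) = -6, which is impossible because n - 1 ≥ 7.
  have h₅ : a + b - 2 * c ≠ 0 := by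
    intro h₅
    have h₆ := h.parameters_eq
    have h₇ : (8 : ℤ) ≤ Fintype.card V := by exact_mod_cast h.card_ge
    have h₈ : c * ((Fintype.card V : ℤ) - 1) = -6 := by linarith
    have : c < 0 := by
      by_contra! hc
      nlinarith
    nlinarith
  exact smul_right_injective _ h₅ h₄

end IsCubicPair

end CubicPair

/-! ### Integer solutions of the local counting equations -/

theorem local_counts_solutions {x y z w a b : ℤ} (hx : 0 ≤ x) (hy : 0 ≤ y)
    (hz : 0 ≤ z) (hw : 0 ≤ w) (hxy : x + y ≤ 3) (hzw : z + w ≤ 3) (hyz : 2 * y + 2 * z ≤ 9)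
    (ha : 2 * x + 2 * z - 4 * y = 3 * a) (hb : 2 * y + 2 * w - 4 * z = 3 * b) :
    (x, y, z, w) ∈ ([(0, 0, 0, 0), (0, 0, 0, 3), (0, 0, 3, 0), (0, 1, 2, 0), (0, 2, 1, 0),
      (0, 3, 0, 0), (0, 3, 0, 3), (1, 0, 2, 1), (1, 1, 1, 1), (1, 2, 0, 1), (2, 0, 1, 2),
      (2, 1, 0, 2), (3, 0, 0, 0), (3, 0, 0, 3), (3, 0, 3, 0)] : List (ℤ × ℤ × ℤ × ℤ)) := by
  -- The unknowns `a` and `b` enter only through divisibility by 3; what remains is a finite check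
  -- over values below 4.
  have h₁ : (2 * x + 2 * z - 4 * y) % 3 = 0 := by omega
  have h₂ : (2 * y + 2 * w - 4 * z) % 3 = 0 := by omega
  clear ha hb
  lift x to ℕ using hx
  lift y to ℕ using hy
  lift z to ℕ using hz
  lift w to ℕ using hw
  have hx' : x < 4 := by omega
  have hy' : y < 4 := by omega
  have hz' : z < 4 := by omega
  have hw' : w < 4 := by omega
  have key : ∀ x y z w : Fin 4, ((x : ℕ) : ℤ) + y ≤ 3 ∧ ((z : ℕ) : ℤ) + w ≤ 3 ∧
      2 * ((y : ℕ) : ℤ) + 2 * z ≤ 9 ∧ (2 * ((x : ℕ) : ℤ) + 2 * z - 4 * y) % 3 = 0 ∧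
      (2 * ((y : ℕ) : ℤ) + 2 * w - 4 * z) % 3 = 0 →
      (((x : ℕ) : ℤ), ((y : ℕ) : ℤ), ((z : ℕ) : ℤ), ((w : ℕ) : ℤ)) ∈
        ([(0, 0, 0, 0), (0, 0, 0, 3), (0, 0, 3, 0), (0, 1, 2, 0), (0, 2, 1, 0), (0, 3, 0, 0),
        (0, 3, 0, 3), (1, 0, 2, 1), (1, 1, 1, 1), (1, 2, 0, 1), (2, 0, 1, 2), (2, 1, 0, 2),
        (3, 0, 0, 0), (3, 0, 0, 3), (3, 0, 3, 0)] : List (ℤ × ℤ × ℤ × ℤ)) := by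
    decide +kernel
  exact key ⟨x, hx'⟩ ⟨y, hy'⟩ ⟨z, hz'⟩ ⟨w, hw'⟩ ⟨hxy, hzw, hyz, h₁, h₂⟩

/-- Here m = n - 7 is odd and K = 6 + 3a + 3b. Since K is even, `c` is even, and the bound -6 ≤ c
leaves three values. -/
theorem coefficient_mem {c m K : ℤ} (hc : -6 ≤ c) (hm : c * m = -K) (hK : 0 < K)
    (hm_pos : 1 ≤ m) (hm_odd : m % 2 = 1) (hK_even : K % 4 = 2 ∨ K = 12) :
    (c = -6 ∧ 6 * m = K) ∨ (c = -4 ∧ 4 * m = K) ∨ (c = -2 ∧ 2 * m = K) := by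
  have : c < 0 := by
    by_contra! h
    nlinarith
  interval_cases c <;> omega

/-- The integer solutions of the local counting equations of a cubic pair. -/
theorem local_counts_classification {x y z w a b c m p n q : ℤ} (hx : 0 ≤ x) (hy : 0 ≤ y)
    (hz : 0 ≤ z) (hw : 0 ≤ w) (hxy : x + y ≤ 3) (hzw : z + w ≤ 3) (hyz : 2 * y + 2 * z ≤ 9)
    (ha : 2 * x + 2 * z - 4 * y = 3 * a) (hb : 2 * y + 2 * w - 4 * z = 3 * b)
    (hm : 6 + 3 * a + 3 * b + c * m = 0) (hm_odd : m % 2 = 1) (hm_pos : 1 ≤ m)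
    (hp : p = 6 - 2 * x - 2 * y) (hn : n = 6 - 2 * z - 2 * w) (hq : q = 9 - 2 * y - 2 * z)
    (hc : -6 ≤ c) (hc₂ : c = -2 → p = q - m ∧ n = q - m ∧ q ≤ 2 * m)
    (hc₄ : c = -4 → p = 0 ∧ q = 2 * m) (hc₆ : c = -6 → p = 0 ∧ q = 3 * m) :
    (a = 4 ∧ b = -4 ∧ x = 3 ∧ z = 3 ∧ (m = 1 ∨ m = 3)) ∨
    (a = -4 ∧ b = 4 ∧ y = 3 ∧ w = 3 ∧ (m = 1 ∨ m = 3)) ∨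
    (a = 2 ∧ b = 2 ∧ x = 3 ∧ w = 3 ∧ (m = 3 ∨ m = 9)) ∨
    (a = -4 ∧ b = 2 ∧ y = 3 ∧ w = 0) ∨
    (a = 2 ∧ b = -4 ∧ z = 3 ∧ x = 0) ∨
    (a = 0 ∧ b = 0 ∧ x = 1 ∧ y = 1 ∧ z = 1 ∧ w = 1) ∨
    (a = 0 ∧ b = -2 ∧ x = 0 ∧ y = 1 ∧ z = 2 ∧ w = 0) ∨
    (a = -2 ∧ b = 0 ∧ x = 0 ∧ y = 2 ∧ z = 1 ∧ w = 0) := by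
  have h := local_counts_solutions hx hy hz hw hxy hzw hyz ha hb
  have key : 0 < 6 + 3 * a + 3 * b →
      ((6 + 3 * a + 3 * b) % 4 = 2 ∨ 6 + 3 * a + 3 * b = 12) →
      (6 * m = 6 + 3 * a + 3 * b ∧ p = 0 ∧ q = 3 * m) ∨
      (4 * m = 6 + 3 * a + 3 * b ∧ p = 0 ∧ q = 2 * m) ∨
      (2 * m = 6 + 3 * a + 3 * b ∧ p = q - m ∧ n = q - m ∧ q ≤ 2 * m) := by
    intro h₁ h₂
    rcases coefficient_mem (c := c) (m := m) hc (by linarith) h₁ hm_pos hm_odd h₂ with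
      ⟨e, h⟩ | ⟨e, h⟩ | ⟨e, h⟩
    exacts [Or.inl ⟨h, hc₆ e⟩, Or.inr (Or.inl ⟨h, hc₄ e⟩), Or.inr (Or.inr ⟨h, hc₂ e⟩)]
  simp only [List.mem_cons, Prod.mk.injEq, List.not_mem_nil, or_false] at h
  clear hm hc hc₂ hc₄ hc₆
  subst hp hn hq
  rcases h with h | h | h | h | h | h | h | h | h | h | h | h | h | h | h <;>
    obtain ⟨rfl, rfl, rfl, rfl⟩ := h
  · exfalso
    rcases key (by omega) (by omega) with h | h | h <;> omega
  · exfalso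
    rcases key (by omega) (by omega) with h | h | h <;> omega
  -- This quadruple and the next three give 6 + 3a + 3b = 0, so `key` does not apply to them. They
  -- are passed on, as is (1, 1, 1, 1), which is consistent with c = -2 and m = 3.
  · exact Or.inr <| Or.inr <| Or.inr <| Or.inr <| Or.inl (by omega)
  · exact Or.inr <| Or.inr <| Or.inr <| Or.inr <| Or.inr <| Or.inr <| Or.inl (by omega)
  · exact Or.inr <| Or.inr <| Or.inr <| Or.inr <| Or.inr <| Or.inr <| Or.inr (by omega)
  · exact Or.inr <| Or.inr <| Or.inr <| Or.inl (by omega)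
  · refine Or.inr <| Or.inl ⟨by omega, by omega, rfl, rfl, ?_⟩
    rcases key (by omega) (by omega) with h | h | h <;> omega
  · exfalso
    rcases key (by omega) (by omega) with h | h | h <;> omega
  · exact Or.inr <| Or.inr <| Or.inr <| Or.inr <| Or.inr <| Or.inl (by omega)
  · exfalso
    rcases key (by omega) (by omega) with h | h | h <;> omega
  · exfalso
    rcases key (by omega) (by omega) with h | h | h <;> omega
  · exfalso
    rcases key (by omega) (by omega) with h | h | h <;> omega
  · exfalso
    rcases key (by omega) (by omega) with h | h | h <;> omega
  · refine Or.inr <| Or.inr <| Or.inl ⟨by omega, by omega, rfl, rfl, ?_⟩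
    rcases key (by omega) (by omega) with h | h | h <;> omega
  · refine Or.inl ⟨by omega, by omega, rfl, rfl, ?_⟩
    rcases key (by omega) (by omega) with h | h | h <;> omega

/-! ### The neighbourhoods of a single vertex -/

section CubicPairLocal

open Classical

variable {V : Type*}

theorem SimpleGraph.adj_triple_of_sum_eq_three {G : SimpleGraph V} {v₁ v₂ v₃ : V}
    (h : G.adjMatrix ℤ v₁ v₂ + G.adjMatrix ℤ v₁ v₃ + G.adjMatrix ℤ v₂ v₃ = 3) {v w : V}
    (hv : v ∈ ({v₁, v₂, v₃} : Finset V)) (hw : w ∈ ({v₁, v₂, v₃} : Finset V)) (hvw : v ≠ w) :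
    G.Adj v w := by
  have h₁ := G.adjMatrix_eq_zero_or_one v₁ v₂
  have h₂ := G.adjMatrix_eq_zero_or_one v₁ v₃
  have h₃ := G.adjMatrix_eq_zero_or_one v₂ v₃
  have e₁ := (G.adjMatrix_eq_one_iff v₁ v₂).1 (by omega)
  have e₂ := (G.adjMatrix_eq_one_iff v₁ v₃).1 (by omega)
  have e₃ := (G.adjMatrix_eq_one_iff v₂ v₃).1 (by omega)
  simp only [Finset.mem_insert, Finset.mem_singleton] at hv hw
  rcases hv with rfl | rfl | rfl <;> rcases hw with rfl | rfl | rfl <;>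
    simp_all [SimpleGraph.adj_comm]

theorem SimpleGraph.not_adj_triple_of_sum_eq_zero {G : SimpleGraph V} {v₁ v₂ v₃ : V}
    (h : G.adjMatrix ℤ v₁ v₂ + G.adjMatrix ℤ v₁ v₃ + G.adjMatrix ℤ v₂ v₃ = 0) {v w : V}
    (hv : v ∈ ({v₁, v₂, v₃} : Finset V)) (hw : w ∈ ({v₁, v₂, v₃} : Finset V)) :
    ¬ G.Adj v w := by
  have h₁ := G.adjMatrix_eq_zero_or_one v₁ v₂
  have h₂ := G.adjMatrix_eq_zero_or_one v₁ v₃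
  have h₃ := G.adjMatrix_eq_zero_or_one v₂ v₃
  have e₁ := mt (G.adjMatrix_eq_one_iff v₁ v₂).2 (by omega)
  have e₂ := mt (G.adjMatrix_eq_one_iff v₁ v₃).2 (by omega)
  have e₃ := mt (G.adjMatrix_eq_one_iff v₂ v₃).2 (by omega)
  simp only [Finset.mem_insert, Finset.mem_singleton] at hv hw
  rcases hv with rfl | rfl | rfl <;> rcases hw with rfl | rfl | rfl <;>
    simp_all [SimpleGraph.adj_comm]

variable [Fintype V]

theorem SimpleGraph.IsRegularOfDegree.exists_neighborFinset_eq {G : SimpleGraph V}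
    (h : G.IsRegularOfDegree 3) (u : V) : ∃ v₁ v₂ v₃, v₁ ≠ v₂ ∧ v₁ ≠ v₃ ∧ v₂ ≠ v₃ ∧
      G.neighborFinset u = {v₁, v₂, v₃} :=
  Finset.card_eq_three.1 ((G.card_neighborFinset_eq_degree u).trans (h.degree_eq u))

namespace IsCubicPair

variable {P N : SimpleGraph V} {a b c : ℤ}

/-- The vertex set splits into u, its three positive neighbours, its three negative neighbours and
the non-neighbours. -/
theorem sum_eq (h : IsCubicPair P N a b c) {u v₁ v₂ v₃ v₄ v₅ v₆ : V}
    (hP : P.neighborFinset u = {v₁, v₂, v₃}) (h₁₂ : v₁ ≠ v₂) (h₁₃ : v₁ ≠ v₃) (h₂₃ : v₂ ≠ v₃)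
    (hN : N.neighborFinset u = {v₄, v₅, v₆}) (h₄₅ : v₄ ≠ v₅) (h₄₆ : v₄ ≠ v₆) (h₅₆ : v₅ ≠ v₆)
    (f : V → ℤ) : ∑ v, f v = f u + (f v₁ + f v₂ + f v₃) + (f v₄ + f v₅ + f v₆) +
      ∑ v with u ≠ v ∧ ¬ P.Adj u v ∧ ¬ N.Adj u v, f v := by
  rw [← SimpleGraph.sum_adjMatrix_mul hP h₁₂ h₁₃ h₂₃,
    ← SimpleGraph.sum_adjMatrix_mul hN h₄₅ h₄₆ h₅₆,
    Finset.sum_filter]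
  have hu : f u = ∑ v, if u = v then f v else 0 := by simp
  rw [hu, ← Finset.sum_add_distrib, ← Finset.sum_add_distrib, ← Finset.sum_add_distrib]
  refine Finset.sum_congr rfl fun v _ => ?_
  have hd := h.disjoint u v
  simp only [SimpleGraph.adjMatrix_apply]
  by_cases huv : u = v
  · subst huv; simp
  by_cases h₁ : P.Adj u v <;> by_cases h₂ : N.Adj u v <;> simp_all

set_option maxHeartbeats 2000000 in
/-- The graphs induced on the positive and negative neighbourhoods of a vertex of a cubic pair,
obtained by counting the walks of length two that start at this vertex. -/
theorem local_structure (h : IsCubicPair P N a b c) (u : V) :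
    (a = 4 ∧ b = -4 ∧ (Fintype.card V = 8 ∨ Fintype.card V = 10) ∧
      ∀ v w, P.Adj u v → P.Adj u w → v ≠ w → P.Adj v w) ∨
    (a = -4 ∧ b = 4 ∧ (Fintype.card V = 8 ∨ Fintype.card V = 10) ∧
      ∀ v w, N.Adj u v → N.Adj u w → v ≠ w → N.Adj v w) ∨
    (a = 2 ∧ b = 2 ∧ (Fintype.card V = 10 ∨ Fintype.card V = 16) ∧
      (∀ v w, P.Adj u v → P.Adj u w → v ≠ w → P.Adj v w) ∧
      ∀ v w, N.Adj u v → N.Adj u w → v ≠ w → N.Adj v w) ∨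
    (a = -4 ∧ b = 2 ∧ (∀ v w, P.Adj u v → P.Adj u w → v ≠ w → N.Adj v w) ∧
      ∀ v w, N.Adj u v → N.Adj u w → ¬ N.Adj v w) ∨
    (a = 2 ∧ b = -4 ∧ (∀ v w, N.Adj u v → N.Adj u w → v ≠ w → P.Adj v w) ∧
      ∀ v w, P.Adj u v → P.Adj u w → ¬ P.Adj v w) := by
  have : Nonempty V := ⟨u⟩
  obtain ⟨v₁, v₂, v₃, h₁₂, h₁₃, h₂₃, hP⟩ := h.pos_regular.exists_neighborFinset_eq u
  obtain ⟨v₄, v₅, v₆, h₄₅, h₄₆, h₅₆, hN⟩ := h.neg_regular.exists_neighborFinset_eq u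
  have hPu : ∀ v, P.Adj u v ↔ v ∈ ({v₁, v₂, v₃} : Finset V) := by
    intro v; rw [← hP, SimpleGraph.mem_neighborFinset]
  have hNu : ∀ v, N.Adj u v ↔ v ∈ ({v₄, v₅, v₆} : Finset V) := by
    intro v; rw [← hN, SimpleGraph.mem_neighborFinset]
  simp only [hPu, hNu]
  have hsum := h.sum_eq hP h₁₂ h₁₃ h₂₃ hN h₄₅ h₄₆ h₅₆
  have hPs := SimpleGraph.sum_adjMatrix_mul hP h₁₂ h₁₃ h₂₃
  have hNs := SimpleGraph.sum_adjMatrix_mul hN h₄₅ h₄₆ h₅₆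
  have hp01 := P.adjMatrix_eq_zero_or_one
  have hn01 := N.adjMatrix_eq_zero_or_one
  have hpn := h.adjMatrix_add_le
  have hps := P.adjMatrix_comm
  have hns := N.adjMatrix_comm
  -- Row u of PN = NP. For v among the neighbours of u it equates edges between the two
  -- neighbourhoods with edges inside one of them.
  have hcomm : ∀ v, N.adjMatrix ℤ v₁ v + N.adjMatrix ℤ v₂ v + N.adjMatrix ℤ v₃ v =
      P.adjMatrix ℤ v₄ v + P.adjMatrix ℤ v₅ v + P.adjMatrix ℤ v₆ v := by
    intro v
    have e := congrFun (congrFun h.commute u) v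
    rwa [Matrix.mul_apply, Matrix.mul_apply, hPs, hNs] at e
  have hsq : ∀ v, ((P.adjMatrix ℤ - N.adjMatrix ℤ) * (P.adjMatrix ℤ - N.adjMatrix ℤ)) u v =
      (P.adjMatrix ℤ v₁ v + P.adjMatrix ℤ v₂ v + P.adjMatrix ℤ v₃ v) +
      (N.adjMatrix ℤ v₄ v + N.adjMatrix ℤ v₅ v + N.adjMatrix ℤ v₆ v) -
      2 * (N.adjMatrix ℤ v₁ v + N.adjMatrix ℤ v₂ v + N.adjMatrix ℤ v₃ v) := by
    intro v
    rw [sub_mul, mul_sub, mul_sub, ← h.commute, Matrix.sub_apply, Matrix.sub_apply,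
      Matrix.sub_apply, Matrix.mul_apply, Matrix.mul_apply, Matrix.mul_apply, hPs, hPs, hNs]
    ring
  have hpos : ∀ v ∈ ({v₁, v₂, v₃} : Finset V), _ = a := fun v hv =>
    (hsq v).symm.trans (h.sq_pos u v ((hPu v).2 hv))
  have hneg : ∀ v ∈ ({v₄, v₅, v₆} : Finset V), _ = b := fun v hv =>
    (hsq v).symm.trans (h.sq_neg u v ((hNu v).2 hv))
  have hnon : ∀ v, u ≠ v → ¬ P.Adj u v → ¬ N.Adj u v → _ = c := fun v h₁ h₂ h₃ =>
    (hsq v).symm.trans (h.sq_nonadj u v h₁ h₂ h₃)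
  have hp_row := h.pos_regular.sum_adjMatrix
  have hn_row := h.neg_regular.sum_adjMatrix
  have hPu' := fun v => (P.adjMatrix_eq_one_iff v u).trans ((P.adj_comm v u).trans (hPu v))
  have hNu' := fun v => (N.adjMatrix_eq_one_iff v u).trans ((N.adj_comm v u).trans (hNu v))
  have hparam := h.parameters_eq
  have hcard := h.card_ge
  have heven := h.pos_regular.even_card
  set p := P.adjMatrix ℤ with hp
  set n := N.adjMatrix ℤ with hn
  have hpd : ∀ v, p v v = 0 := fun v => by simp [hp]
  have hnd : ∀ v, n v v = 0 := fun v => by simp [hn]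
  have hp1 := (hPu' v₁).2 (by simp)
  have hp2 := (hPu' v₂).2 (by simp)
  have hp3 := (hPu' v₃).2 (by simp)
  have hn4 := (hNu' v₄).2 (by simp)
  have hn5 := (hNu' v₅).2 (by simp)
  have hn6 := (hNu' v₆).2 (by simp)
  have ha1 := hpos v₁ (by simp)
  have ha2 := hpos v₂ (by simp)
  have ha3 := hpos v₃ (by simp)
  have hb4 := hneg v₄ (by simp)
  have hb5 := hneg v₅ (by simp)
  have hb6 := hneg v₆ (by simp)
  have c1 := hcomm v₁
  have c2 := hcomm v₂
  have c3 := hcomm v₃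
  have c4 := hcomm v₄
  have c5 := hcomm v₅
  have c6 := hcomm v₆
  set M : Finset V := {v | u ≠ v ∧ ¬ P.Adj u v ∧ ¬ N.Adj u v} with hM
  have hMc := hsum fun _ => 1
  have sp := hsum fun v => p v₁ v + p v₂ v + p v₃ v
  have sn := hsum fun v => n v₄ v + n v₅ v + n v₆ v
  have sq := hsum fun v => n v₁ v + n v₂ v + n v₃ v
  rw [Finset.sum_add_distrib, Finset.sum_add_distrib, hp_row, hp_row, hp_row] at sp
  rw [Finset.sum_add_distrib, Finset.sum_add_distrib, hn_row, hn_row, hn_row] at sn sq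
  set F := ∑ v ∈ M, (p v₁ v + p v₂ v + p v₃ v) with hF
  set K := ∑ v ∈ M, (n v₄ v + n v₅ v + n v₆ v) with hK
  set Q := ∑ v ∈ M, (n v₁ v + n v₂ v + n v₃ v) with hQ
  simp only [Finset.sum_const, Finset.card_univ, nsmul_eq_mul, mul_one] at hMc
  have nonneg : ∀ i j, 0 ≤ p i j ∧ 0 ≤ n i j := fun i j =>
    ⟨by rcases hp01 i j with e | e <;> simp [e], by rcases hn01 i j with e | e <;> simp [e]⟩
  -- The three quantities are the entries at (u, v) of P², N² and PN. Each vertex contributes to at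
  -- most one of two edge-disjoint graphs; the last bound first rewrites PN as NP.
  have bound : ∀ v, 0 ≤ p v₁ v + p v₂ v + p v₃ v ∧ 0 ≤ n v₄ v + n v₅ v + n v₆ v ∧
      0 ≤ n v₁ v + n v₂ v + n v₃ v ∧
      (p v₁ v + p v₂ v + p v₃ v) + (n v₁ v + n v₂ v + n v₃ v) ≤ 3 ∧
      (n v₄ v + n v₅ v + n v₆ v) + (n v₁ v + n v₂ v + n v₃ v) ≤ 3 := by
    intro v
    have e := hcomm v
    refine ⟨?_, ?_, ?_, ?_, ?_⟩ <;>
      linarith [(nonneg v₁ v).1, (nonneg v₂ v).1, (nonneg v₃ v).1, (nonneg v₁ v).2,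
        (nonneg v₂ v).2, (nonneg v₃ v).2, (nonneg v₄ v).2, (nonneg v₅ v).2, (nonneg v₆ v).2,
        hpn v₁ v, hpn v₂ v, hpn v₃ v, hpn v₄ v, hpn v₅ v, hpn v₆ v]
  have hdeg : ∀ v, (p v₁ v + p v₂ v + p v₃ v) + (p v₄ v + p v₅ v + p v₆ v) ≤ 3 ∧
      (n v₁ v + n v₂ v + n v₃ v) + (n v₄ v + n v₅ v + n v₆ v) ≤ 3 := by
    intro v
    have e₁ := hsum (p v)
    have e₂ := hsum (n v)
    rw [hp_row] at e₁
    rw [hn_row] at e₂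
    simp only [hps v, hns v] at e₁ e₂
    have f₁ := Finset.sum_nonneg fun w (_ : w ∈ M) => (nonneg w v).1
    have f₂ := Finset.sum_nonneg fun w (_ : w ∈ M) => (nonneg w v).2
    push_cast at e₁ e₂
    exact ⟨by linarith [(nonneg u v).1], by linarith [(nonneg u v).2]⟩
  have hnonM : ∀ v ∈ M, (p v₁ v + p v₂ v + p v₃ v) + (n v₄ v + n v₅ v + n v₆ v) -
      2 * (n v₁ v + n v₂ v + n v₃ v) = c := by
    intro v hv
    simp only [hM, Finset.mem_filter, Finset.mem_univ, true_and] at hv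
    exact hnon v hv.1 hv.2.1 hv.2.2
  -- A non-neighbour exists since n ≥ 8, and the PN entry there is at most 3.
  have hc : -6 ≤ c := by
    obtain ⟨v, hv⟩ : M.Nonempty := Finset.card_pos.1 (by clear * - hMc hcard; omega)
    have h₁ := hnonM v hv
    have h₂ := bound v
    clear * - h₁ h₂
    omega
  have sum_M : ∀ (f : V → ℤ) (s t : ℤ),
      (∀ v ∈ M, f v = s * (n v₁ v + n v₂ v + n v₃ v) + t) → ∑ v ∈ M, f v = s * Q + t * M.card := by
    intro f s t hf
    rw [Finset.sum_congr rfl hf, Finset.sum_add_distrib, ← Finset.mul_sum, Finset.sum_const,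
      nsmul_eq_mul, mul_comm t]
  -- By `bound`, c = -2 forces the (P², N², PN) entries at a non-neighbour to be (0, 0, 1) or (1, 1,
  -- 2). Likewise c = -4 forces (0, 0, 2), and c = -6 forces (0, 0, 3).
  have hc₂ : c = -2 → F = Q - M.card ∧ K = Q - M.card ∧ Q ≤ 2 * M.card := by
    intro e
    have e₁ := sum_M _ 1 (-1) fun v hv => (by
      have h₁ := hnonM v hv; have h₂ := bound v; clear * - h₁ h₂ e; omega :
      p v₁ v + p v₂ v + p v₃ v = _)
    have e₂ := sum_M _ 1 (-1) fun v hv => (by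
      have h₁ := hnonM v hv; have h₂ := bound v; clear * - h₁ h₂ e; omega :
      n v₄ v + n v₅ v + n v₆ v = _)
    have e₃ : Q ≤ M.card • 2 := Finset.sum_le_card_nsmul M _ 2 fun v hv => by
      have h₁ := hnonM v hv; have h₂ := bound v; clear * - h₁ h₂ e; omega
    rw [nsmul_eq_mul] at e₃
    refine ⟨?_, ?_, ?_⟩ <;> linarith
  have hc₄ : c = -4 → F = 0 ∧ Q = 2 * M.card := by
    intro e
    have e₁ := sum_M _ 0 0 fun v hv => (by
      have h₁ := hnonM v hv; have h₂ := bound v; clear * - h₁ h₂ e; omega :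
      p v₁ v + p v₂ v + p v₃ v = _)
    have e₂ := sum_M _ 0 2 fun v hv => (by
      have h₁ := hnonM v hv; have h₂ := bound v; clear * - h₁ h₂ e; omega :
      n v₁ v + n v₂ v + n v₃ v = _)
    refine ⟨?_, ?_⟩ <;> linarith
  have hc₆ : c = -6 → F = 0 ∧ Q = 3 * M.card := by
    intro e
    have e₁ := sum_M _ 0 0 fun v hv => (by
      have h₁ := hnonM v hv; have h₂ := bound v; clear * - h₁ h₂ e; omega :
      p v₁ v + p v₂ v + p v₃ v = _)
    have e₂ := sum_M _ 0 3 fun v hv => (by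
      have h₁ := hnonM v hv; have h₂ := bound v; clear * - h₁ h₂ e; omega :
      n v₁ v + n v₂ v + n v₃ v = _)
    refine ⟨?_, ?_⟩ <;> linarith
  have hMcard : (M.card : ℤ) = Fintype.card V - 7 := by linarith
  have hMcard' : M.card + 7 = Fintype.card V := by clear * - hMc; omega
  rw [← hMcard] at hparam
  have bk1 := (bound v₁).2.1
  have bk2 := (bound v₂).2.1
  have bk3 := (bound v₃).2.1
  have deg1 := hdeg v₁
  have deg2 := hdeg v₂
  have deg3 := hdeg v₃
  have deg4 := hdeg v₄
  have deg5 := hdeg v₅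
  have deg6 := hdeg v₆
  simp only [hpd, hnd, hps v₂ v₁, hps v₃ v₁, hps v₃ v₂, hps v₅ v₄, hps v₆ v₄, hps v₆ v₅,
    hns v₂ v₁, hns v₃ v₁, hns v₃ v₂, hns v₅ v₄, hns v₆ v₄, hns v₆ v₅, hps v₄ v₁, hps v₄ v₂,
    hps v₄ v₃, hps v₅ v₁, hps v₅ v₂, hps v₅ v₃, hps v₆ v₁, hps v₆ v₂, hps v₆ v₃, hns v₄ v₁,
    hns v₄ v₂, hns v₄ v₃, hns v₅ v₁, hns v₅ v₂, hns v₅ v₃, hns v₆ v₁, hns v₆ v₂, hns v₆ v₃]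
    at bk1 bk2 bk3 deg1 deg2 deg3 deg4 deg5 deg6 ha1 ha2 ha3 hb4 hb5 hb6 c1 c2 c3 c4 c5 c6
      sp sn sq
  have d₁₂ := hpn v₁ v₂
  have d₁₃ := hpn v₁ v₃
  have d₂₃ := hpn v₂ v₃
  have d₄₅ := hpn v₄ v₅
  have d₄₆ := hpn v₄ v₆
  have d₅₆ := hpn v₅ v₆
  obtain ⟨k₁₂, l₁₂⟩ := nonneg v₁ v₂
  obtain ⟨k₁₃, l₁₃⟩ := nonneg v₁ v₃
  obtain ⟨k₂₃, l₂₃⟩ := nonneg v₂ v₃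
  obtain ⟨k₄₅, l₄₅⟩ := nonneg v₄ v₅
  obtain ⟨k₄₆, l₄₆⟩ := nonneg v₄ v₆
  obtain ⟨k₅₆, l₅₆⟩ := nonneg v₅ v₆
  have hnu : ∀ v, p v u = 1 → n v u = 0 := fun v hv => by
    have h₁ := hpn v u
    have h₂ := (nonneg v u).2
    linarith
  have hodd : (M.card : ℤ) % 2 = 1 := by
    rw [Nat.even_iff] at heven
    clear * - heven hMcard'
    omega
  have hMpos : 1 ≤ (M.card : ℤ) := by
    clear * - hcard hMcard'
    omega
  -- Each of P², N² and PN accounts for nine walks from u. Three of the P² walks and three of the N²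
  -- walks return to u, none of the PN walks does; this gives the constants 6, 6 and 9 for the walks
  -- ending at non-neighbours.
  have main := local_counts_classification (a := a) (b := b) (c := c) (m := M.card)
    (x := p v₁ v₂ + p v₁ v₃ + p v₂ v₃) (y := n v₁ v₂ + n v₁ v₃ + n v₂ v₃)
    (z := p v₄ v₅ + p v₄ v₆ + p v₅ v₆) (w := n v₄ v₅ + n v₄ v₆ + n v₅ v₆)
    (p := F) (n := K) (q := Q)
    (by linarith) (by linarith) (by linarith) (by linarith) (by linarith) (by linarith)
    -- The nine pairs between the neighbourhoods carry 2y positive and 2z negative edges, without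
    -- overlap.
    (by
      have := hpn v₁ v₄
      have := hpn v₁ v₅
      have := hpn v₁ v₆
      have := hpn v₂ v₄
      have := hpn v₂ v₅
      have := hpn v₂ v₆
      have := hpn v₃ v₄
      have := hpn v₃ v₅
      have := hpn v₃ v₆
      linarith)
    (by linarith) (by linarith) hparam hodd hMpos
    (by push_cast at sp; linarith) (by push_cast at sn; linarith)
    (by push_cast at sq; linarith [hnu v₁ hp1, hnu v₂ hp2, hnu v₃ hp3])
    hc hc₂ hc₄ hc₆
  have hp12 := hp01 v₁ v₂
  have hp13 := hp01 v₁ v₃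
  have hp23 := hp01 v₂ v₃
  have hn12 := hn01 v₁ v₂
  have hn13 := hn01 v₁ v₃
  have hn23 := hn01 v₂ v₃
  rcases main with ⟨rfl, rfl, hx, hz, hm⟩ | ⟨rfl, rfl, hy, hw, hm⟩ | ⟨rfl, rfl, hx, hw, hm⟩ |
    ⟨rfl, rfl, hy, hw⟩ | ⟨rfl, rfl, hz, hx⟩ | ⟨rfl, rfl, hx, hy, hz, hw⟩ |
    ⟨rfl, rfl, hx, hy, hz, hw⟩ | ⟨rfl, rfl, hx, hy, hz, hw⟩
  · exact Or.inl ⟨rfl, rfl, by clear * - hm hMcard'; omega, fun v w =>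
      SimpleGraph.adj_triple_of_sum_eq_three hx⟩
  · exact Or.inr <| Or.inl ⟨rfl, rfl, by clear * - hm hMcard'; omega, fun v w =>
      SimpleGraph.adj_triple_of_sum_eq_three hw⟩
  · exact Or.inr <| Or.inr <| Or.inl ⟨rfl, rfl, by clear * - hm hMcard'; omega, fun v w =>
      SimpleGraph.adj_triple_of_sum_eq_three hx, fun v w =>
      SimpleGraph.adj_triple_of_sum_eq_three hw⟩
  · exact Or.inr <| Or.inr <| Or.inr <| Or.inl ⟨rfl, rfl, fun v w =>
      SimpleGraph.adj_triple_of_sum_eq_three hy, fun v w =>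
      SimpleGraph.not_adj_triple_of_sum_eq_zero hw⟩
  · exact Or.inr <| Or.inr <| Or.inr <| Or.inr ⟨rfl, rfl, fun v w =>
      SimpleGraph.adj_triple_of_sum_eq_three hz, fun v w =>
      SimpleGraph.not_adj_triple_of_sum_eq_zero hx⟩
  -- With a = 0 and N² entries nonnegative, the positive degree of each vᵢ inside the positive
  -- neighbourhood is at most twice its negative degree there. With one edge of each sign among
  -- three vertices, some end of the positive edge misses the negative one.
  · exfalso
    have g₁ : p v₁ v₂ + p v₁ v₃ ≤ 2 * (n v₁ v₂ + n v₁ v₃) := by linarith [bk1]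
    have g₂ : p v₁ v₂ + p v₂ v₃ ≤ 2 * (n v₁ v₂ + n v₂ v₃) := by linarith [bk2]
    have g₃ : p v₁ v₃ + p v₂ v₃ ≤ 2 * (n v₁ v₃ + n v₂ v₃) := by linarith [bk3]
    clear * - g₁ g₂ g₃ hx hy d₁₂ d₁₃ d₂₃ hp12 hp13 hp23 hn12 hn13 hn23
    omega
  -- Inside the negative neighbourhood, let d be the positive degree of one of its vertices. By b =
  -- -2 and commutativity it has 2d - 2 positive edges to the positive neighbourhood, so 3d - 2 ≤ 3
  -- and d ≤ 1; but two edges on three vertices share an end.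
  · exfalso
    have g₄ : 3 * (p v₄ v₅ + p v₄ v₆) ≤ 5 := by linarith [deg4.1]
    have g₅ : 3 * (p v₄ v₅ + p v₅ v₆) ≤ 5 := by linarith [deg5.1]
    have g₆ : 3 * (p v₄ v₆ + p v₅ v₆) ≤ 5 := by linarith [deg6.1]
    clear * - g₄ g₅ g₆ hz
    omega
  -- The previous argument with the signs exchanged.
  · exfalso
    have g₁ : 3 * (n v₁ v₂ + n v₁ v₃) ≤ 5 := by linarith [deg1.2]
    have g₂ : 3 * (n v₁ v₂ + n v₂ v₃) ≤ 5 := by linarith [deg2.2]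
    have g₃ : 3 * (n v₁ v₃ + n v₂ v₃) ≤ 5 := by linarith [deg3.2]
    clear * - g₁ g₂ g₃ hy
    omega

end IsCubicPair

end CubicPairLocal

/-! ### Grids from transversal equivalence relations -/

section SetoidGrid

open Classical

variable {V : Type*} [Fintype V]

/-- If all classes of an equivalence relation have `k` elements, then the type is a product of
the quotient and `Fin k`. -/
theorem Setoid.exists_equiv_quotient_prod (r : Setoid V) {k : ℕ}
    (hk : ∀ u, (Finset.univ.filter fun v => r u v).card = k) :
    ∃ e : V ≃ Quotient r × Fin k, ∀ u, (e u).1 = ⟦u⟧ := by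
  have hfiber : ∀ q : Quotient r, Nonempty ({v // (⟦v⟧ : Quotient r) = q} ≃ Fin k) := by
    intro q
    induction q using Quotient.inductionOn with
    | h u =>
      refine ⟨Fintype.equivFinOfCardEq ?_⟩
      rw [← hk u, Fintype.card_subtype]
      congr 1
      ext v
      simp only [Finset.mem_filter, Finset.mem_univ, true_and]
      rw [Quotient.eq]
      exact ⟨r.symm', r.symm'⟩
  exact ⟨(Equiv.sigmaFiberEquiv (fun v => (⟦v⟧ : Quotient r))).symm.trans
    ((Equiv.sigmaCongrRight fun q => (hfiber q).some).trans (Equiv.sigmaEquivProd _ _)),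
    fun u => rfl⟩

theorem Setoid.card_eq_card_quotient_mul (r : Setoid V) {k : ℕ}
    (hk : ∀ u, (Finset.univ.filter fun v => r u v).card = k) :
    Fintype.card V = Fintype.card (Quotient r) * k := by
  obtain ⟨e, -⟩ := r.exists_equiv_quotient_prod hk
  rw [Fintype.card_congr e, Fintype.card_prod, Fintype.card_fin]

/-- A type with an equivalence relation all of whose classes have `k` elements is a rectangle
whose rows are the classes. -/
theorem Setoid.exists_equiv_fin_prod (r : Setoid V) {k m : ℕ} (hk_pos : 0 < k)
    (hk : ∀ u, (Finset.univ.filter fun v => r u v).card = k) (hm : Fintype.card V = m * k) :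
    ∃ e : V ≃ Fin m × Fin k, ∀ u v, (e u).1 = (e v).1 ↔ r u v := by
  obtain ⟨e, he⟩ := r.exists_equiv_quotient_prod hk
  have hq : Fintype.card (Quotient r) = m :=
    Nat.eq_of_mul_eq_mul_right hk_pos ((r.card_eq_card_quotient_mul hk).symm.trans hm)
  refine ⟨e.trans ((Fintype.equivFinOfCardEq hq).prodCongr (Equiv.refl _)), fun u v => ?_⟩
  simp only [Equiv.trans_apply, Equiv.prodCongr_apply, Prod.map_fst, he,
    EmbeddingLike.apply_eq_iff_eq]
  exact Quotient.eq

/-- Two transversal equivalence relations with classes of constant size whose numbers of classes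
multiply to the number of elements are the rows and columns of a grid. -/
theorem Setoid.exists_equiv_grid (r s : Setoid V) {k l m n : ℕ} (hk_pos : 0 < k) (hl_pos : 0 < l)
    (hk : ∀ u, (Finset.univ.filter fun v => r u v).card = k)
    (hl : ∀ u, (Finset.univ.filter fun v => s u v).card = l)
    (hm : Fintype.card V = m * k) (hn : Fintype.card V = n * l) (hmn : Fintype.card V = m * n)
    (hrs : ∀ u v, r u v → s u v → u = v) :
    ∃ e : V ≃ Fin m × Fin n,
      ∀ u v, ((e u).1 = (e v).1 ↔ r u v) ∧ ((e u).2 = (e v).2 ↔ s u v) := by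
  obtain ⟨e, he⟩ := r.exists_equiv_fin_prod hk_pos hk hm
  obtain ⟨f, hf⟩ := s.exists_equiv_fin_prod hl_pos hl hn
  have hinj : Function.Injective fun v => ((e v).1, (f v).1) := by
    intro u v huv
    rw [Prod.mk.injEq] at huv
    exact hrs u v ((he u v).1 huv.1) ((hf u v).1 huv.2)
  have hbij := (Fintype.bijective_iff_injective_and_card _).2
    ⟨hinj, by rw [Fintype.card_prod, Fintype.card_fin, Fintype.card_fin, hmn]⟩
  exact ⟨Equiv.ofBijective _ hbij, fun u v => ⟨he u v, hf u v⟩⟩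

end SetoidGrid

/-! ### Global structure of cubic pairs -/

section CubicPairGlobal

open Classical

/-- In a graph in which any two neighbours of a vertex are equal or adjacent, being equal or
adjacent is an equivalence relation. -/
def SimpleGraph.eqOrAdjSetoid {V : Type*} (G : SimpleGraph V)
    (h : ∀ u v w, G.Adj u v → G.Adj u w → v ≠ w → G.Adj v w) : Setoid V where
  r u v := u = v ∨ G.Adj u v
  iseqv := by
    refine ⟨fun u => Or.inl rfl, ?_, ?_⟩
    · rintro u v (rfl | huv)
      exacts [Or.inl rfl, Or.inr huv.symm]
    · rintro u v w (rfl | huv) (rfl | hvw)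
      · exact Or.inl rfl
      · exact Or.inr hvw
      · exact Or.inr huv
      · by_cases huw : u = w
        · exact Or.inl huw
        · exact Or.inr (h v u w huv.symm hvw huw)

variable {V : Type*} [Fintype V]

theorem SimpleGraph.IsRegularOfDegree.card_eqOrAdjSetoid {G : SimpleGraph V} {k : ℕ}
    (hG : G.IsRegularOfDegree k)
    (h : ∀ u v w, G.Adj u v → G.Adj u w → v ≠ w → G.Adj v w) (u : V) :
    (Finset.univ.filter fun v => G.eqOrAdjSetoid h u v).card = k + 1 := by
  have : (Finset.univ.filter fun v => G.eqOrAdjSetoid h u v) = insert u (G.neighborFinset u) := by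
    ext v
    simp only [Finset.mem_filter, Finset.mem_univ, true_and, Finset.mem_insert,
      SimpleGraph.mem_neighborFinset]
    exact or_congr_left eq_comm
  rw [this, Finset.card_insert_of_notMem (by simp), SimpleGraph.card_neighborFinset_eq_degree,
    hG.degree_eq]

theorem SimpleGraph.card_filter_not_adj (G : SimpleGraph V) (u : V) :
    (Finset.univ.filter fun v => ¬ G.Adj u v).card = Fintype.card V - G.degree u := by
  rw [← SimpleGraph.card_neighborFinset_eq_degree, ← Finset.card_compl,
    SimpleGraph.neighborFinset_eq_filter, Finset.compl_filter]

/-- If every vertex has exactly one non-neighbour besides itself, non-adjacency is an equivalence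
relation. -/
def SimpleGraph.notAdjSetoid (G : SimpleGraph V)
    (h : ∀ u, (Finset.univ.filter fun v => ¬ G.Adj u v).card = 2) : Setoid V where
  r u v := ¬ G.Adj u v
  iseqv := by
    refine ⟨fun u => G.irrefl, fun {u v} huv hvu => huv hvu.symm, ?_⟩
    intro u v w huv hvw huw
    have hne : u ≠ v := by rintro rfl; exact hvw huw
    have hne' : v ≠ w := by rintro rfl; exact huv huw
    have hsub : ({u, v, w} : Finset V) ⊆ Finset.univ.filter fun x => ¬ G.Adj v x := by
      intro x hx
      simp only [Finset.mem_insert, Finset.mem_singleton] at hx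
      rcases hx with rfl | rfl | rfl
      · simpa [SimpleGraph.adj_comm] using huv
      · simp
      · simpa using hvw
    have := Finset.card_le_card hsub
    rw [h v, Finset.card_eq_three.2 ⟨u, v, w, hne, huw.ne, hne', rfl⟩] at this
    omega

theorem SimpleGraph.card_notAdjSetoid (G : SimpleGraph V)
    (h : ∀ u, (Finset.univ.filter fun v => ¬ G.Adj u v).card = 2) (u : V) :
    (Finset.univ.filter fun v => G.notAdjSetoid h u v).card = 2 := by
  rw [← h u]
  congr 1
  ext v
  simp only [Finset.mem_filter, Finset.mem_univ, true_and]
  rfl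

theorem SimpleGraph.IsRegularOfDegree.card_filter_not_adj {G : SimpleGraph V} {k n : ℕ}
    (h : G.IsRegularOfDegree k) (hV : Fintype.card V = n) (u : V) :
    (Finset.univ.filter fun v => ¬ G.Adj u v).card = n - k := by
  rw [G.card_filter_not_adj, h.degree_eq, hV]

namespace IsCubicPair

variable {P N : SimpleGraph V} {a b c : ℤ}

theorem classification (h : IsCubicPair P N a b c) [Nonempty V] :
    (Fintype.card V = 8 ∧ ∀ u v w, P.Adj u v → P.Adj u w → v ≠ w → P.Adj v w) ∨
    (Fintype.card V = 8 ∧ ∀ u v w, N.Adj u v → N.Adj u w → v ≠ w → N.Adj v w) ∨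
    (Fintype.card V = 16 ∧ (∀ u v w, P.Adj u v → P.Adj u w → v ≠ w → P.Adj v w) ∧
      ∀ u v w, N.Adj u v → N.Adj u w → v ≠ w → N.Adj v w) := by
  have hloc := h.local_structure
  -- The classes have four elements each, and 4 does not divide 10.
  have card_ne : ∀ G : SimpleGraph V, G.IsRegularOfDegree 3 →
      (∀ u v w, G.Adj u v → G.Adj u w → v ≠ w → G.Adj v w) → Fintype.card V ≠ 10 := by
    intro G hG hcl
    rw [Setoid.card_eq_card_quotient_mul _ (hG.card_eqOrAdjSetoid hcl)]
    omega
  obtain ⟨u⟩ := ‹Nonempty V›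
  rcases hloc u with ⟨rfl, rfl, hn, -⟩ | ⟨rfl, rfl, hn, -⟩ | ⟨rfl, rfl, hn, -, -⟩ |
    ⟨rfl, rfl, hu, -⟩ | ⟨rfl, rfl, hu, -⟩
  -- The pair (a, b) is the same at every vertex and distinguishes the five local alternatives, so
  -- all vertices share the alternative found at u.
  · norm_num at hloc
    have hcl := fun u => (hloc u).2
    exact Or.inl ⟨hn.resolve_right (card_ne P h.pos_regular hcl), hcl⟩
  · norm_num at hloc
    have hcl := fun u => (hloc u).2
    exact Or.inr (Or.inl ⟨hn.resolve_right (card_ne N h.neg_regular hcl), hcl⟩)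
  · norm_num at hloc
    have hcl := fun u => (hloc u).2.1
    exact Or.inr (Or.inr ⟨hn.resolve_left (card_ne P h.pos_regular hcl), hcl,
      fun u => (hloc u).2.2⟩)
  · obtain ⟨v₁, v₂, v₃, h₁₂, h₁₃, h₂₃, hP⟩ := h.pos_regular.exists_neighborFinset_eq u
    have hm : ∀ v ∈ ({v₁, v₂, v₃} : Finset V), P.Adj u v := by
      intro v hv; rwa [← hP, SimpleGraph.mem_neighborFinset] at hv
    norm_num at hloc
    -- The positive neighbours of u are pairwise joined by negative edges, so v₂ and v₃ are adjacent
    -- negative neighbours of v₁, against the local structure at v₁.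
    exact absurd (hu v₂ v₃ (hm _ (by simp)) (hm _ (by simp)) h₂₃) ((hloc v₁).2 v₂ v₃
      (hu v₁ v₂ (hm _ (by simp)) (hm _ (by simp)) h₁₂)
      (hu v₁ v₃ (hm _ (by simp)) (hm _ (by simp)) h₁₃))
  · obtain ⟨v₁, v₂, v₃, h₁₂, h₁₃, h₂₃, hN⟩ := h.neg_regular.exists_neighborFinset_eq u
    have hm : ∀ v ∈ ({v₁, v₂, v₃} : Finset V), N.Adj u v := by
      intro v hv; rwa [← hN, SimpleGraph.mem_neighborFinset] at hv
    norm_num at hloc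
    exact absurd (hu v₂ v₃ (hm _ (by simp)) (hm _ (by simp)) h₂₃) ((hloc v₁).2 v₂ v₃
      (hu v₁ v₂ (hm _ (by simp)) (hm _ (by simp)) h₁₂)
      (hu v₁ v₃ (hm _ (by simp)) (hm _ (by simp)) h₁₃))

theorem sup_regular (h : IsCubicPair P N a b c) : (P ⊔ N).IsRegularOfDegree 6 := by
  intro u
  have hd : Disjoint (P.neighborFinset u) (N.neighborFinset u) := by
    rw [Finset.disjoint_left]
    intro v; simpa using h.disjoint u v
  have : (P ⊔ N).neighborFinset u = P.neighborFinset u ∪ N.neighborFinset u := by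
    ext v; simp
  rw [← SimpleGraph.card_neighborFinset_eq_degree, this, Finset.card_union_of_disjoint hd,
    SimpleGraph.card_neighborFinset_eq_degree, SimpleGraph.card_neighborFinset_eq_degree,
    h.pos_regular.degree_eq, h.neg_regular.degree_eq]

/-- The union of the two graphs is 6-regular on 8 vertices, so non-adjacency has classes of size
two. These four pairs are transversal to the two positive K₄'s and give the first coordinate; the
K₄'s give the second. -/
theorem exists_equiv_of_card_eq_eight (h : IsCubicPair P N a b c) (hV : Fintype.card V = 8)
    (hcl : ∀ u v w, P.Adj u v → P.Adj u w → v ≠ w → P.Adj v w) :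
    ∃ e : V ≃ Fin 4 × Fin 2, ∀ u v,
      (P.Adj u v ↔ (e u).1 ≠ (e v).1 ∧ (e u).2 = (e v).2) ∧
      (N.Adj u v ↔ (e u).1 ≠ (e v).1 ∧ (e u).2 ≠ (e v).2) := by
  have hr := SimpleGraph.IsRegularOfDegree.card_filter_not_adj (G := P ⊔ N) (k := 6)
    (by convert h.sup_regular) hV
  obtain ⟨e, he⟩ := Setoid.exists_equiv_grid ((P ⊔ N).notAdjSetoid hr) (P.eqOrAdjSetoid hcl)
    (k := 2) (l := 4) (m := 4) (n := 2) (by norm_num) (by norm_num)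
    (SimpleGraph.card_notAdjSetoid _ hr)
    (h.pos_regular.card_eqOrAdjSetoid hcl) hV hV hV (by
      rintro u v huv (rfl | h')
      · rfl
      · exact absurd (Or.inl h') huv)
  refine ⟨e, fun u v => ?_⟩
  have h₁ : (e u).1 = (e v).1 ↔ ¬ (P.Adj u v ∨ N.Adj u v) := (he u v).1
  have h₂ : (e u).2 = (e v).2 ↔ u = v ∨ P.Adj u v := (he u v).2
  have h₃ := h.disjoint u v
  have h₄ : N.Adj u v → u ≠ v := fun hN => hN.ne
  have h₅ : P.Adj u v → u ≠ v := fun hN => hN.ne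
  simp only [ne_eq, h₁, h₂]
  tauto

/-- Edge-disjointness makes the positive and negative K₄'s transversal: four of each, hence rows and
columns of a 4 × 4 grid. -/
theorem exists_equiv_of_card_eq_sixteen (h : IsCubicPair P N a b c) (hV : Fintype.card V = 16)
    (hP : ∀ u v w, P.Adj u v → P.Adj u w → v ≠ w → P.Adj v w)
    (hN : ∀ u v w, N.Adj u v → N.Adj u w → v ≠ w → N.Adj v w) :
    ∃ e : V ≃ Fin 4 × Fin 4, ∀ u v,
      (P.Adj u v ↔ (e u).1 = (e v).1 ∧ (e u).2 ≠ (e v).2) ∧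
      (N.Adj u v ↔ (e u).1 ≠ (e v).1 ∧ (e u).2 = (e v).2) := by
  obtain ⟨e, he⟩ := Setoid.exists_equiv_grid (P.eqOrAdjSetoid hP) (N.eqOrAdjSetoid hN)
    (k := 4) (l := 4) (m := 4) (n := 4) (by norm_num) (by norm_num)
    (h.pos_regular.card_eqOrAdjSetoid hP) (h.neg_regular.card_eqOrAdjSetoid hN) hV hV hV (by
      rintro u v (rfl | h₁) (h₂ | h₂)
      exacts [rfl, rfl, h₂, absurd h₂ (h.disjoint u v h₁)])
  refine ⟨e, fun u v => ?_⟩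
  have h₁ : (e u).1 = (e v).1 ↔ u = v ∨ P.Adj u v := (he u v).1
  have h₂ : (e u).2 = (e v).2 ↔ u = v ∨ N.Adj u v := (he u v).2
  have h₃ := h.disjoint u v
  have h₄ : N.Adj u v → u ≠ v := fun hN => hN.ne
  have h₅ : P.Adj u v → u ≠ v := fun hN => hN.ne
  simp only [ne_eq, h₁, h₂]
  tauto

end IsCubicPair

end CubicPairGlobal

/-! ### Signed graphs through their positive and negative parts -/

namespace SignedGraph

section Parts

variable {V W : Type*}

theorem adj_iff (S : SignedGraph V) (u v : V) :
    S.graph.Adj u v ↔ S.posPart.Adj u v ∨ S.negPart.Adj u v := by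
  refine ⟨fun h => ?_, fun h => h.elim (fun h => h.1) fun h => h.1⟩
  rcases Int.units_eq_one_or (S.sign ⟨s(u, v), h⟩) with e | e
  exacts [Or.inl ⟨h, e⟩, Or.inr ⟨h, e⟩]

theorem not_negPart_adj {S : SignedGraph V} {u v : V} (h : S.posPart.Adj u v) :
    ¬ S.negPart.Adj u v := by
  rintro ⟨h₁, h₂⟩
  obtain ⟨h₃, h₄⟩ := h
  rw [h₄] at h₂
  exact absurd h₂ (by decide)

theorem posPart_neg (S : SignedGraph V) : (-S).posPart = S.negPart := by
  ext u v
  refine exists_congr fun h => ?_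
  change -S.sign ⟨s(u, v), h⟩ = 1 ↔ _
  rw [neg_eq_iff_eq_neg]

theorem negPart_neg (S : SignedGraph V) : (-S).negPart = S.posPart := by
  ext u v
  refine exists_congr fun h => ?_
  change -S.sign ⟨s(u, v), h⟩ = -1 ↔ _
  rw [neg_inj]

open Classical in
theorem posPart_ofPositive_adj {G P : SimpleGraph V} {u v : V} :
    (ofPositive G P).posPart.Adj u v ↔ G.Adj u v ∧ P.Adj u v := by
  change (∃ _ : G.Adj u v, (if s(u, v) ∈ P.edgeSet then (1 : ℤˣ) else -1) = 1) ↔ _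
  rw [exists_prop]
  refine and_congr_right fun _ => ?_
  by_cases h : P.Adj u v <;> simp [h]

open Classical in
theorem negPart_ofPositive_adj {G P : SimpleGraph V} {u v : V} :
    (ofPositive G P).negPart.Adj u v ↔ G.Adj u v ∧ ¬ P.Adj u v := by
  change (∃ _ : G.Adj u v, (if s(u, v) ∈ P.edgeSet then (1 : ℤˣ) else -1) = -1) ↔ _
  rw [exists_prop]
  refine and_congr_right fun _ => ?_
  by_cases h : P.Adj u v <;> simp [h]

/-- A signed graph isomorphism is a bijection preserving the positive and the negative part. -/
theorem isIsomorphic_iff (S : SignedGraph V) (T : SignedGraph W) :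
    S.IsIsomorphic T ↔ ∃ e : V ≃ W, ∀ u v,
      (S.posPart.Adj u v ↔ T.posPart.Adj (e u) (e v)) ∧
      (S.negPart.Adj u v ↔ T.negPart.Adj (e u) (e v)) := by
  constructor
  · rintro ⟨f, hf⟩
    have key : ∀ ε u v, (S.part ε).Adj u v ↔ (T.part ε).Adj (f u) (f v) := by
      intro ε u v
      constructor
      · rintro ⟨h, hs⟩
        exact ⟨f.map_rel_iff.2 h, (hf ⟨s(u, v), h⟩).trans hs⟩
      · rintro ⟨h, hs⟩
        exact ⟨f.map_rel_iff.1 h, (hf ⟨s(u, v), f.map_rel_iff.1 h⟩).symm.trans hs⟩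
    exact ⟨f.toEquiv, fun u v => ⟨key 1 u v, key (-1) u v⟩⟩
  · rintro ⟨e, he⟩
    refine ⟨⟨e, fun {u v} => ?_⟩, ?_⟩
    · rw [adj_iff, adj_iff, (he u v).1, (he u v).2]
    · rintro ⟨x, hx⟩
      induction x using Sym2.inductionOn with
      | hf u v =>
        rcases Int.units_eq_one_or (S.sign ⟨s(u, v), hx⟩) with h | h
        · obtain ⟨_, h'⟩ := (he u v).1.1 ⟨hx, h⟩
          exact h'.trans h.symm
        · obtain ⟨_, h'⟩ := (he u v).2.1 ⟨hx, h⟩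
          exact h'.trans h.symm

open Classical in
theorem adjMatrix_eq (S : SignedGraph V) :
    S.adjMatrix = S.posPart.adjMatrix ℤ - S.negPart.adjMatrix ℤ := by
  ext u v
  rw [Matrix.sub_apply, SimpleGraph.adjMatrix_apply, SimpleGraph.adjMatrix_apply, adjMatrix,
    Matrix.of_apply]
  by_cases hp : S.posPart.Adj u v
  · obtain ⟨h, hs⟩ := id hp
    simp [h, hs, hp, not_negPart_adj hp]
  by_cases hn : S.negPart.Adj u v
  · obtain ⟨h, hs⟩ := id hn
    simp [h, hs, hp, hn]
  · have h : ¬ S.graph.Adj u v := by rw [adj_iff]; tauto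
    simp [h, hp, hn]

theorem adjMatrix_neg (S : SignedGraph V) : (-S).adjMatrix = -S.adjMatrix := by
  rw [adjMatrix_eq, adjMatrix_eq, posPart_neg, negPart_neg, neg_sub]

theorem not_isHomogeneous {S : SignedGraph V} {u v x y : V} (hp : S.posPart.Adj u v)
    (hn : S.negPart.Adj x y) : ¬ S.IsHomogeneous := by
  obtain ⟨h₁, h₂⟩ := hp
  obtain ⟨h₃, h₄⟩ := hn
  intro h
  have := h ⟨s(u, v), h₁⟩ ⟨s(x, y), h₃⟩
  rw [h₂, h₄] at this
  exact absurd this (by decide)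

end Parts

/-! ### Invariants, negation, isomorphism, and computation on the models -/

section Finite

open Classical

variable {V W : Type*} [Fintype V] [Fintype W]

theorem _root_.SimpleGraph.degree_congr {G H : SimpleGraph V} (h : G = H) (u : V) :
    G.degree u = H.degree u := by
  subst h
  rfl

theorem degree_eq (S : SignedGraph V) (u : V) :
    S.graph.degree u = S.posPart.degree u + S.negPart.degree u := by
  have hd : Disjoint (S.posPart.neighborFinset u) (S.negPart.neighborFinset u) := by
    rw [Finset.disjoint_left]
    intro v
    simpa only [SimpleGraph.mem_neighborFinset] using not_negPart_adj
  rw [← SimpleGraph.card_neighborFinset_eq_degree, ← SimpleGraph.card_neighborFinset_eq_degree,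
    ← SimpleGraph.card_neighborFinset_eq_degree, ← Finset.card_union_of_disjoint hd]
  congr 1
  ext v
  simp [adj_iff]

/-- The positive and negative degrees have sum 6 and difference 0, so both are 3. -/
theorem SquareEntries.isCubicPair {S : SignedGraph V} {r : ℕ} {a b c : ℤ}
    (h : S.SquareEntries r a b c) (h₁ : S.IsRegular 6) (h₂ : S.IsNetRegular 0) :
    IsCubicPair S.posPart S.negPart a b c := by
  have hdeg : ∀ u, S.posPart.degree u = 3 ∧ S.negPart.degree u = 3 := by
    intro u
    have e₁ := h₁ u
    have e₂ := h₂ u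
    rw [degree_eq] at e₁
    rw [netDegree] at e₂
    omega
  refine ⟨fun u v => not_negPart_adj, fun u => (hdeg u).1, fun u => (hdeg u).2, ?_, ?_, ?_⟩ <;>
    rw [← adjMatrix_eq]
  exacts [h.pos, h.neg,
    fun u v hne hp hn => h.nonadj u v hne fun h => ((S.adj_iff u v).1 h).elim hp hn]

/-- The signed graph is connected, `6`-regular and `0` net-regular with edges of both signs, and
the square of its adjacency matrix has entries prescribed by `a`, `b`, `c`. -/
structure IsZeroNetSRSG (S : SignedGraph V) (a b c : ℤ) : Prop where
  connected : S.graph.Connected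
  regular : S.IsRegular 6
  netRegular : S.IsNetRegular 0
  exists_pos : ∃ u v, S.posPart.Adj u v
  exists_neg : ∃ u v, S.negPart.Adj u v
  squareEntries : S.SquareEntries 6 a b c

namespace IsZeroNetSRSG

variable {S : SignedGraph V} {T : SignedGraph W} {a b c : ℤ}

theorem not_isHomogeneous (h : S.IsZeroNetSRSG a b c) : ¬ S.IsHomogeneous := by
  obtain ⟨u, v, hp⟩ := h.exists_pos
  obtain ⟨x, y, hn⟩ := h.exists_neg
  exact SignedGraph.not_isHomogeneous hp hn

theorem isStronglyRegular (h : S.IsZeroNetSRSG a b c) : S.IsStronglyRegular := by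
  refine ⟨fun h' => h.not_isHomogeneous h'.1, fun e => ?_, 6, a, b, c, h.squareEntries⟩
  obtain ⟨u, v, hp, -⟩ := h.exists_pos
  rw [e] at hp
  exact hp

theorem neg (h : S.IsZeroNetSRSG a b c) : (-S).IsZeroNetSRSG b a c := by
  have e : (-S).adjMatrix * (-S).adjMatrix = S.adjMatrix * S.adjMatrix := by
    rw [adjMatrix_neg, neg_mul_neg]
  refine ⟨h.connected, h.regular, fun v => ?_, by rw [posPart_neg]; exact h.exists_neg,
    by rw [negPart_neg]; exact h.exists_pos, ⟨?_, ?_, ?_, ?_⟩⟩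
  · have := h.netRegular v
    rw [netDegree] at this ⊢
    rw [SimpleGraph.degree_congr S.posPart_neg, SimpleGraph.degree_congr S.negPart_neg]
    omega
  · rw [e]; exact h.squareEntries.diag
  · rw [e, posPart_neg]; exact h.squareEntries.neg
  · rw [e, negPart_neg]; exact h.squareEntries.pos
  · rw [e]; exact h.squareEntries.nonadj

theorem of_isIsomorphic (h : T.IsZeroNetSRSG a b c) (hST : S.IsIsomorphic T) :
    S.IsZeroNetSRSG a b c := by
  obtain ⟨f, -⟩ := id hST
  obtain ⟨e, he⟩ := (isIsomorphic_iff S T).1 hST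
  have hpos : ∀ u v, S.posPart.Adj u v ↔ T.posPart.Adj (e u) (e v) := fun u v => (he u v).1
  have hneg : ∀ u v, S.negPart.Adj u v ↔ T.negPart.Adj (e u) (e v) := fun u v => (he u v).2
  let P : S.posPart ≃g T.posPart := ⟨e, fun {u v} => (hpos u v).symm⟩
  let N : S.negPart ≃g T.negPart := ⟨e, fun {u v} => (hneg u v).symm⟩
  have hA : ∀ u v, S.adjMatrix u v = T.adjMatrix (e u) (e v) := by
    intro u v
    simp only [adjMatrix_eq, Matrix.sub_apply, SimpleGraph.adjMatrix_apply, hpos, hneg]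
  have hA₂ : ∀ u v, (S.adjMatrix * S.adjMatrix) u v = (T.adjMatrix * T.adjMatrix) (e u) (e v) := by
    intro u v
    simp only [Matrix.mul_apply, hA]
    exact Equiv.sum_comp e fun w => T.adjMatrix (e u) w * T.adjMatrix w (e v)
  refine ⟨f.connected_iff.2 h.connected, fun u => ?_, fun u => ?_, ?_, ?_, ⟨?_, ?_, ?_, ?_⟩⟩
  · rw [← f.degree_eq u]; exact h.regular _
  · rw [netDegree, ← P.degree_eq u, ← N.degree_eq u]; exact h.netRegular _
  · obtain ⟨u, v, huv⟩ := h.exists_pos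
    exact ⟨e.symm u, e.symm v, by simpa [hpos] using huv⟩
  · obtain ⟨u, v, huv⟩ := h.exists_neg
    exact ⟨e.symm u, e.symm v, by simpa [hneg] using huv⟩
  · intro u; rw [hA₂]; exact h.squareEntries.diag _
  · intro u v huv; rw [hA₂]; exact h.squareEntries.pos _ _ ((hpos u v).1 huv)
  · intro u v huv; rw [hA₂]; exact h.squareEntries.neg _ _ ((hneg u v).1 huv)
  · intro u v hne huv
    rw [hA₂]
    refine h.squareEntries.nonadj _ _ (e.injective.ne hne) ?_
    rwa [adj_iff, ← hpos, ← hneg, ← adj_iff]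

theorem hasParameters (h : S.IsZeroNetSRSG a b c) {n : ℕ} (hn : Fintype.card V = n) :
    S.HasParameters n 6 a b c :=
  ⟨h.isStronglyRegular, hn, h.squareEntries⟩

end IsZeroNetSRSG

theorem _root_.SimpleGraph.degree_eq_card_filter {G : SimpleGraph V} {p : V → V → Prop}
    [∀ u, DecidablePred (p u)] (h : ∀ u v, G.Adj u v ↔ p u v) (u : V) :
    G.degree u = (Finset.univ.filter (p u)).card := by
  rw [← SimpleGraph.card_neighborFinset_eq_degree, SimpleGraph.neighborFinset_eq_filter]
  congr 1
  ext v
  simp [h]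

end Finite

/-- The invariants of a signed graph whose positive and negative adjacency are decidable can be
computed. -/
theorem isZeroNetSRSG_of_decidable {V : Type*} [Fintype V] [DecidableEq V] (S : SignedGraph V)
    {a b c : ℤ} (p n : V → V → Bool) (hp : ∀ u v, S.posPart.Adj u v ↔ p u v = true)
    (hn : ∀ u v, S.negPart.Adj u v ↔ n u v = true)
    (hdeg : ∀ u, (Finset.univ.filter fun v => p u v = true).card = 3 ∧
      (Finset.univ.filter fun v => n u v = true).card = 3)
    (hsq : ∀ u v, ∑ w, ((if p u w then 1 else 0) - (if n u w then 1 else 0) : ℤ) *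
      ((if p w v then 1 else 0) - (if n w v then 1 else 0)) =
      if u = v then 6 else if p u v then a else if n u v then b else c)
    -- Any two vertices are joined by at most two steps, a step being allowed to stay in place.
    (hconn : ∀ u v, ∃ w, (u = w ∨ p u w = true ∨ n u w = true) ∧
      (w = v ∨ p w v = true ∨ n w v = true)) [Nonempty V] : S.IsZeroNetSRSG a b c := by
  have hpd : ∀ u, _ = _ := SimpleGraph.degree_eq_card_filter hp
  have hnd : ∀ u, _ = _ := SimpleGraph.degree_eq_card_filter hn
  have hA : ∀ u v, (S.adjMatrix * S.adjMatrix) u v =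
      if u = v then 6 else if p u v then a else if n u v then b else c := by
    intro u v
    rw [← hsq]
    simp [adjMatrix_eq, Matrix.mul_apply, SimpleGraph.adjMatrix_apply, hp, hn]
  have hstep : ∀ u v, (u = v ∨ p u v = true ∨ n u v = true) → S.graph.Reachable u v := by
    rintro u v (rfl | h)
    · rfl
    · exact SimpleGraph.Adj.reachable ((S.adj_iff u v).2 (by rwa [hp, hn]))
  have hne : ∀ u v, p u v = true ∨ n u v = true → u ≠ v := by
    rintro u v h rfl
    rw [← hp, ← hn] at h
    simp at h
  have u₀ := Classical.arbitrary V
  refine ⟨⟨fun u v => ?_⟩, fun u => ?_, fun u => ?_, ?_, ?_, ⟨?_, ?_, ?_, ?_⟩⟩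
  · obtain ⟨w, h₁, h₂⟩ := hconn u v
    exact (hstep u w h₁).trans (hstep w v h₂)
  · rw [degree_eq, hpd, hnd, (hdeg u).1, (hdeg u).2]
  · rw [netDegree, hpd, hnd, (hdeg u).1, (hdeg u).2]; rfl
  · obtain ⟨v, hv⟩ := Finset.card_pos.1 ((hdeg u₀).1 ▸ (by norm_num : 0 < 3))
    exact ⟨u₀, v, (hp _ _).2 (by simpa using hv)⟩
  · obtain ⟨v, hv⟩ := Finset.card_pos.1 ((hdeg u₀).2 ▸ (by norm_num : 0 < 3))
    exact ⟨u₀, v, (hn _ _).2 (by simpa using hv)⟩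
  · intro u; simp [hA]
  · intro u v huv
    rw [hp] at huv
    simp [hA, huv, hne u v (Or.inl huv)]
  · intro u v huv
    have h' : ¬ S.posPart.Adj u v := fun h => not_negPart_adj h huv
    rw [hp] at h'
    rw [hn] at huv
    simp [hA, huv, h', hne u v (Or.inr huv)]
  · intro u v huv h
    rw [adj_iff, hp, hn, not_or] at h
    simp [hA, huv, h.1, h.2]

theorem S8_posPart_adj (u v : Fin 4 × Fin 2) :
    S8.posPart.Adj u v ↔ u.1 ≠ v.1 ∧ u.2 = v.2 := by
  rw [S8, posPart_ofPositive_adj, SimpleGraph.fromRel_adj, SimpleGraph.fromRel_adj]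
  revert u v
  decide +kernel

theorem S8_negPart_adj (u v : Fin 4 × Fin 2) :
    S8.negPart.Adj u v ↔ u.1 ≠ v.1 ∧ u.2 ≠ v.2 := by
  rw [S8, negPart_ofPositive_adj, SimpleGraph.fromRel_adj, SimpleGraph.fromRel_adj]
  revert u v
  decide +kernel

theorem S16_posPart_adj (u v : Fin 4 × Fin 4) :
    S16.posPart.Adj u v ↔ u.1 = v.1 ∧ u.2 ≠ v.2 := by
  rw [S16, posPart_ofPositive_adj, SimpleGraph.fromRel_adj, SimpleGraph.fromRel_adj]
  revert u v
  decide +kernel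

theorem S16_negPart_adj (u v : Fin 4 × Fin 4) :
    S16.negPart.Adj u v ↔ u.1 ≠ v.1 ∧ u.2 = v.2 := by
  rw [S16, negPart_ofPositive_adj, SimpleGraph.fromRel_adj, SimpleGraph.fromRel_adj]
  revert u v
  decide +kernel

theorem isZeroNetSRSG_S8 : S8.IsZeroNetSRSG 4 (-4) (-6) := by
  refine isZeroNetSRSG_of_decidable S8 (fun u v => decide (u.1 ≠ v.1 ∧ u.2 = v.2))
    (fun u v => decide (u.1 ≠ v.1 ∧ u.2 ≠ v.2)) (fun u v => ?_) (fun u v => ?_) ?_ ?_ ?_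
  · rw [S8_posPart_adj, decide_eq_true_iff]
  · rw [S8_negPart_adj, decide_eq_true_iff]
  all_goals decide +kernel

theorem isZeroNetSRSG_S16 : S16.IsZeroNetSRSG 2 2 (-2) := by
  refine isZeroNetSRSG_of_decidable S16 (fun u v => decide (u.1 = v.1 ∧ u.2 ≠ v.2))
    (fun u v => decide (u.1 ≠ v.1 ∧ u.2 = v.2)) (fun u v => ?_) (fun u v => ?_) ?_ ?_ ?_
  · rw [S16_posPart_adj, decide_eq_true_iff]
  · rw [S16_negPart_adj, decide_eq_true_iff]
  all_goals decide +kernel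

end SignedGraph

/-! ### Classification and properties of the models -/

namespace SignedGraph

section Classification

open Classical

variable {V : Type*} [Fintype V]

/-- Negative K₄'s on eight vertices reduce to positive ones by `IsCubicPair.swap`. The negation of
`S16` needs no separate case: the grid description already gives `S16` itself. -/
theorem isIsomorphic_of_regular_of_netRegular {S : SignedGraph V} (h₁ : S.graph.Connected)
    (h₂ : S.IsRegular 6) (h₃ : S.IsNetRegular 0) (h₄ : S.IsStronglyRegular) :
    S.IsIsomorphic S8 ∨ S.IsIsomorphic (-S8) ∨ S.IsIsomorphic S16 := by
  obtain ⟨-, -, r, a, b, c, hsq⟩ := h₄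
  have h := hsq.isCubicPair h₂ h₃
  have := h₁.nonempty
  simp only [isIsomorphic_iff, posPart_neg, negPart_neg, S8_posPart_adj, S8_negPart_adj,
    S16_posPart_adj, S16_negPart_adj]
  rcases h.classification with ⟨hV, hcl⟩ | ⟨hV, hcl⟩ | ⟨hV, hP, hN⟩
  · exact Or.inl (h.exists_equiv_of_card_eq_eight hV hcl)
  · obtain ⟨e, he⟩ := h.swap.exists_equiv_of_card_eq_eight hV hcl
    exact Or.inr (Or.inl ⟨e, fun u v => (he u v).symm⟩)
  · exact Or.inr (Or.inr (h.exists_equiv_of_card_eq_sixteen hV hP hN))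

theorem IsZeroNetSRSG.isSRSG {S : SignedGraph V} {a b c : ℤ} (h : S.IsZeroNetSRSG a b c) :
    S.graph.Connected ∧ S.IsRegular 6 ∧ S.IsNetRegular 0 ∧ S.IsSRSG :=
  ⟨h.connected, h.regular, h.netRegular, h.isStronglyRegular, h.not_isHomogeneous⟩

theorem S16_isIsomorphic_neg : S16.IsIsomorphic (-S16) := by
  simp only [isIsomorphic_iff, posPart_neg, negPart_neg, S16_posPart_adj, S16_negPart_adj]
  exact ⟨Equiv.prodComm _ _, fun u v => ⟨and_comm, and_comm⟩⟩

/-- The entry of the squared matrix at positive edges is an isomorphism invariant, equal to 4 for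
one graph and -4 for the other. -/
theorem S8_not_isIsomorphic_neg : ¬ S8.IsIsomorphic (-S8) := by
  intro h
  obtain ⟨u, v, huv⟩ := isZeroNetSRSG_S8.exists_pos
  have h₁ := isZeroNetSRSG_S8.squareEntries.pos u v huv
  have h₂ := (isZeroNetSRSG_S8.neg.of_isIsomorphic h).squareEntries.pos u v huv
  rw [h₁] at h₂
  norm_num at h₂

theorem S8_graph_adj (u v : Fin 4 × Fin 2) : S8.graph.Adj u v ↔ u.1 ≠ v.1 := by
  rw [adj_iff, S8_posPart_adj, S8_negPart_adj]
  tauto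

/-- The complement of a 6-regular graph on 8 vertices is a perfect matching, so the graph is
complete multipartite with four parts of size two. -/
theorem isRegularOfDegree_six_iff {G : SimpleGraph V} (hV : Fintype.card V = 8) :
    G.IsRegularOfDegree 6 ↔ Nonempty (G ≃g S8.graph) := by
  constructor
  · intro h
    have hr := h.card_filter_not_adj hV
    obtain ⟨e, he⟩ := Setoid.exists_equiv_fin_prod (G.notAdjSetoid hr) (k := 2) (m := 4)
      (by norm_num) (G.card_notAdjSetoid hr) hV
    refine ⟨⟨e, fun {u v} => ?_⟩⟩
    rw [S8_graph_adj]
    exact not_iff_comm.1 (he u v).symm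
  · rintro ⟨f⟩ u
    rw [← f.degree_eq u]
    exact isZeroNetSRSG_S8.regular _

theorem isDisjointUnionOfK4_of_regular {G : SimpleGraph V} (hG : G.IsRegularOfDegree 3)
    (h : ∀ u v w, G.Adj u v → G.Adj u w → v ≠ w → G.Adj v w) : IsDisjointUnionOfK4 G := by
  -- Being equal or adjacent is already transitive, so reachability adds nothing and components are
  -- closed neighbourhoods.
  have hreach : ∀ u v, G.Reachable u v ↔ G.eqOrAdjSetoid h u v := by
    intro u v
    constructor
    · rintro ⟨p⟩
      induction p with
      | nil => exact Setoid.refl' _ _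
      | cons hadj _ ih => exact Setoid.trans' _ (Or.inr hadj) ih
    · rintro (rfl | huv)
      exacts [SimpleGraph.Reachable.refl _, huv.reachable]
  intro C
  induction C using SimpleGraph.ConnectedComponent.ind with
  | h u =>
    have hsupp : ∀ v, v ∈ (G.connectedComponentMk u).supp ↔ G.eqOrAdjSetoid h u v := by
      intro v
      rw [SimpleGraph.ConnectedComponent.mem_supp_iff, SimpleGraph.ConnectedComponent.eq,
        SimpleGraph.reachable_comm, hreach]
    constructor
    · intro v hv w hw hvw
      exact (Setoid.trans' _ (Setoid.symm' _ ((hsupp v).1 hv)) ((hsupp w).1 hw)).resolve_left hvw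
    · refine Eq.trans ?_ (hG.card_eqOrAdjSetoid h u)
      rw [← Set.ncard_coe_finset]
      congr 1
      ext v
      simp [hsupp]

end Classification

end SignedGraph

open Classical in
theorem theorem3p32 :
    (∀ {V : Type*} [Fintype V] (S : SignedGraph V),
      (S.graph.Connected ∧ S.IsRegular 6 ∧ S.IsNetRegular 0 ∧ S.IsSRSG) ↔
        (S.IsIsomorphic SignedGraph.S8 ∨ S.IsIsomorphic (-SignedGraph.S8) ∨
          S.IsIsomorphic SignedGraph.S16 ∨ S.IsIsomorphic (-SignedGraph.S16))) ∧
    SignedGraph.S8.HasParameters 8 6 4 (-4) (-6) ∧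
    (-SignedGraph.S8).HasParameters 8 6 (-4) 4 (-6) ∧
    SignedGraph.S16.HasParameters 16 6 2 2 (-2) ∧
    (-SignedGraph.S16).HasParameters 16 6 2 2 (-2) ∧
    (∀ {W : Type*} [Fintype W] (G : SimpleGraph W), Fintype.card W = 8 →
      (G.IsRegularOfDegree 6 ↔ Nonempty (G ≃g SignedGraph.S8.graph))) ∧
    IsDisjointUnionOfK4 SignedGraph.S16.posPart ∧
    IsDisjointUnionOfK4 SignedGraph.S16.negPart ∧
    ¬ SignedGraph.S8.IsIsomorphic (-SignedGraph.S8) ∧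
    SignedGraph.S16.IsIsomorphic (-SignedGraph.S16) := by
  have h₈ := SignedGraph.isZeroNetSRSG_S8
  have h₁₆ := SignedGraph.isZeroNetSRSG_S16
  have hpair := h₁₆.squareEntries.isCubicPair h₁₆.regular h₁₆.netRegular
  refine ⟨fun S => ⟨fun ⟨h₁, h₂, h₃, h₄, _⟩ => ?_, ?_⟩, h₈.hasParameters rfl,
    h₈.neg.hasParameters rfl, h₁₆.hasParameters rfl, h₁₆.neg.hasParameters rfl,
    fun G hW => SignedGraph.isRegularOfDegree_six_iff hW,
    SignedGraph.isDisjointUnionOfK4_of_regular hpair.pos_regular ?_,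
    SignedGraph.isDisjointUnionOfK4_of_regular hpair.neg_regular ?_,
    SignedGraph.S8_not_isIsomorphic_neg, SignedGraph.S16_isIsomorphic_neg⟩
  · rcases SignedGraph.isIsomorphic_of_regular_of_netRegular h₁ h₂ h₃ h₄ with h | h | h
    exacts [Or.inl h, Or.inr (Or.inl h), Or.inr (Or.inr (Or.inl h))]
  · rintro (h | h | h | h)
    exacts [(h₈.of_isIsomorphic h).isSRSG, (h₈.neg.of_isIsomorphic h).isSRSG,
      (h₁₆.of_isIsomorphic h).isSRSG, (h₁₆.neg.of_isIsomorphic h).isSRSG]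
  · simp only [SignedGraph.S16_posPart_adj]
    rintro u v w ⟨h₁, -⟩ ⟨h₂, -⟩ hne
    have h : v.1 = w.1 := h₁.symm.trans h₂
    exact ⟨h, fun h' => hne (Prod.ext h h')⟩
  · simp only [SignedGraph.S16_negPart_adj]
    rintro u v w ⟨-, h₁⟩ ⟨-, h₂⟩ hne
    have h : v.2 = w.2 := h₁.symm.trans h₂
    exact ⟨fun h' => hne (Prod.ext h' h), h⟩
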